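/- Fix $\kappa>0$, $P>0$, $\bar p\in\mathbb R$, and for $\epsilon>0$ put $\Delta\alpha=\kappa\epsilon$, $\alpha_k=k\Delta\alpha$, $p_j=\bar p+j\epsilon$ ($k,j\in\mathbb Z$), $\vec\alpha=(\cos\alpha,\sin\alpha)$, $\vec\alpha_k=(\cos\alpha_k,\sin\alpha_k)$. All sums below run over the grid of pairs $(k,j)$ with $|\alpha_k|\le\pi$ and $|p_j|\le P$. Let $\mathcal H f(t)=\frac1\pi\,\mathrm{p.v.}\!\int_{\mathbb R}\frac{f(s)}{t-s}\,ds$ denote the Hilbert transform. Assume: (1) Noise: for each $\epsilon>0$ the real random variables $\eta_{k,j}$ (which may depend on $\epsilon$), indexed by the grid, are independent, have finite third absolute moments, and satisfy $\mathbb E\,\eta_{k,j}=0$, $\mathbb E\,\eta_{k,j}^2=\sigma^2(\alpha_k,p_j)\Delta\alpha$ and $\mathbb E|\eta_{k,j}|^3\le c(\Delta\alpha)^{3/2}$, where $\sigma\in C^1([-\pi,\pi]\times[-P,P])$ and the constant $c$ does not depend on $\epsilon,k,j$. (2) Kernel: $\varphi:\mathbb R\to\mathbb R$ is compactly supported, $\varphi\in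 C^M$ and $\varphi^{(M+1)}\in L^\infty(\mathbb R)$ for some integer $M\ge3$ (that is, $\varphi^{(M)}$ is absolutely continuous with essentially bounded derivative), and $\int\varphi=1$. (3) Center: $x_0\in\mathbb R^2$, $|x_0|\le P$, and $\kappa|x_0|$ is irrational of type $\nu$ for some $\nu>0$, meaning that for every $\nu_1>\nu$ there is $c>0$ with $m^{\nu_1}\,\mathrm{dist}(m\kappa|x_0|,\mathbb Z)\ge c$ for all integers $m\ge1$. Moreover $\sigma^2(\alpha,\vec\alpha\cdot x_0)\ne0$ for all $\alpha$ in some nonempty open set $U\subset[-\pi,\pi]$. (4) $M>\nu+1$. Then for every fixed $\check x\in\mathbb R^2$, with $a_k=(\vec\alpha_k\cdot x_0-\bar p)/\epsilon$ and $\varphi'$ the derivative of $\varphi$, $$\frac{\sum_{k,j}\big|\mathcal H\varphi'(a_k-j+\vec\alpha_k\cdot\check x)\big|^3\,\mathbb E|\eta_{k,j}|^3}{\Big[\sum_{k,j}\big(\mathcal H\varphi'(a_k-j+\vec\alpha_k\cdot\check x)\big)^2\,\mathbb E\,\eta_{k,j}^2\Big]^{3/2}}=O(\epsilon^{1/2}),\qquad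 \epsilon\to0^+ .$$ Moreover, as $\epsilon\to0^+$, $$\sum_{k,j}\big(\mathcal H\varphi'(a_k-j+\vec\alpha_k\cdot\check x)\big)^2\,\mathbb E\,\eta_{k,j}^2\;\longrightarrow\; C\int_{-\pi}^{\pi}\sigma^2(\alpha,\vec\alpha\cdot x_0)\,d\alpha>0,\qquad C=\int_{\mathbb R}\big(\mathcal H\varphi'(r)\big)^2dr ,$$ so that in particular the denominator above is positive for all sufficiently small $\epsilon$. -/

import Mathlib

open MeasureTheory ProbabilityTheory Filter Topology

namespace NoisyFBP

noncomputable section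

/-- The Hilbert transform, `(1/π) p.v. ∫ f(s) / (t - s) ds`, the principal value being the limit
of the integrals over `|t - s| > δ` as `δ → 0+`. -/
def hilbertTransform (f : ℝ → ℝ) (t : ℝ) : ℝ :=
  limUnder (𝓝[>] (0 : ℝ)) fun δ : ℝ =>
    (1 / Real.pi) * ∫ s in {s : ℝ | δ < |t - s|}, f s / (t - s)

/-- The distance from a real number to the integers. -/
def distInt (r : ℝ) : ℝ := Metric.infDist r (Set.range fun n : ℤ => (n : ℝ))

/-- The real number `s` is irrational of type `ν`. -/
def IsIrrationalOfType (s ν : ℝ) : Prop :=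
  0 < ν ∧ Irrational s ∧
    ∀ ν₁ : ℝ, ν < ν₁ → ∃ c : ℝ, 0 < c ∧
      ∀ m : ℕ, 1 ≤ m → c ≤ (m : ℝ) ^ ν₁ * distInt ((m : ℝ) * s)

/-- The unit vector with polar angle `α`. -/
def unitVec (α : ℝ) : EuclideanSpace ℝ (Fin 2) := !₂[Real.cos α, Real.sin α]

/-- The angular grid point `α_k = k Δα`, where `Δα = κ ε`. -/
def angle (κ ε : ℝ) (k : ℤ) : ℝ := k * (κ * ε)

/-- The radial grid point `p_j = pbar + j Δp`, where `Δp = ε`. -/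
def offset (pbar ε : ℝ) (j : ℤ) : ℝ := pbar + j * ε

/-- The indices `(k, j)` of the grid points of the observation space, that is, those with
`|α_k| ≤ π` and `|p_j| ≤ P` (see `mem_grid`). -/
def grid (κ pbar P ε : ℝ) : Finset (ℤ × ℤ) :=
  Finset.Icc ⌈-Real.pi / (κ * ε)⌉ ⌊Real.pi / (κ * ε)⌋ ×ˢ
    Finset.Icc ⌈(-P - pbar) / ε⌉ ⌊(P - pbar) / ε⌋

theorem mem_grid {κ pbar P ε : ℝ} (hκ : 0 < κ) (hε : 0 < ε) (i : ℤ × ℤ) :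
    i ∈ grid κ pbar P ε ↔ |angle κ ε i.1| ≤ Real.pi ∧ |offset pbar ε i.2| ≤ P := by
  have h : 0 < κ * ε := mul_pos hκ hε
  simp only [grid, angle, offset, Finset.mem_product, Finset.mem_Icc, Int.ceil_le, Int.le_floor,
    abs_le, div_le_iff₀ h, le_div_iff₀ h, div_le_iff₀ hε, le_div_iff₀ hε]
  constructor
  · rintro ⟨⟨h1, h2⟩, h3, h4⟩
    exact ⟨⟨h1, h2⟩, by linarith, by linarith⟩
  · rintro ⟨⟨h1, h2⟩, h3, h4⟩
    exact ⟨⟨h1, h2⟩, by linarith, by linarith⟩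

/-- The assumptions on the noise. For each step size `ε`, the variable `η ε k j` is the noise in
the measurement at the grid point `(α_k, p_j)`. -/
structure NoiseAssumptions {Ω : Type*} [MeasurableSpace Ω] (μ : Measure Ω) (κ pbar P : ℝ)
    (σ : ℝ → ℝ → ℝ) (η : ℝ → ℤ → ℤ → Ω → ℝ) : Prop where
  /-- The noise variables have finite third (hence also first and second) moments. -/
  memLp : ∀ ε : ℝ, 0 < ε → ∀ i ∈ grid κ pbar P ε, MemLp (η ε i.1 i.2) 3 μ
  indep : ∀ ε : ℝ, 0 < ε → iIndepFun (fun i : grid κ pbar P ε => η ε i.1.1 i.1.2) μ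
  mean_zero : ∀ ε : ℝ, 0 < ε → ∀ i ∈ grid κ pbar P ε, ∫ ω, η ε i.1 i.2 ω ∂μ = 0
  sigma_contDiffOn : ContDiffOn ℝ 1 (Function.uncurry σ)
    (Set.Icc (-Real.pi) Real.pi ×ˢ Set.Icc (-P) P)
  second_moment : ∀ ε : ℝ, 0 < ε → ∀ i ∈ grid κ pbar P ε,
    ∫ ω, (η ε i.1 i.2 ω) ^ 2 ∂μ = (σ (angle κ ε i.1) (offset pbar ε i.2)) ^ 2 * (κ * ε)
  third_moment : ∃ c : ℝ, ∀ ε : ℝ, 0 < ε → ∀ i ∈ grid κ pbar P ε,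
    ∫ ω, |η ε i.1 i.2 ω| ^ 3 ∂μ ≤ c * (κ * ε) ^ (3 / 2 : ℝ)

/-- The assumptions on the kernel. -/
structure KernelAssumptions (M : ℕ) (φ : ℝ → ℝ) : Prop where
  compactSupport : HasCompactSupport φ
  three_le : 3 ≤ M
  contDiff : ContDiff ℝ M φ
  /-- The derivative of order `M + 1` is in `L^∞`: the derivative of order `M` is absolutely
  continuous, and its almost everywhere derivative `g` is essentially bounded. -/
  deriv_bounded : ∃ g : ℝ → ℝ, MemLp g ⊤ volume ∧
    ∀ a b : ℝ, iteratedDeriv M φ b - iteratedDeriv M φ a = ∫ t in a..b, g t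
  integral_eq_one : ∫ t, φ t = 1

/-- The assumptions on the centre `x₀` of the neighbourhood. -/
structure CenterAssumptions (κ P ν : ℝ) (σ : ℝ → ℝ → ℝ) (x₀ : EuclideanSpace ℝ (Fin 2)) :
    Prop where
  /-- All lines through `x₀` are in the observation space, the domain of `σ`. -/
  norm_le : ‖x₀‖ ≤ P
  type : IsIrrationalOfType (κ * ‖x₀‖) ν
  sigma_ne_zero : ∃ U : Set ℝ, IsOpen U ∧ U.Nonempty ∧ U ⊆ Set.Icc (-Real.pi) Real.pi ∧
    ∀ α ∈ U, (σ α (inner ℝ (unitVec α) x₀)) ^ 2 ≠ 0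

/-- The weight `(H φ')(a_k - j + α⃗_k · x)`, with `a_k = (α⃗_k · x₀ - pbar) / ε`, that multiplies
the noise variable with index `(k, j)` in the reconstruction at `x₀ + ε x`. -/
def weight (κ pbar : ℝ) (φ : ℝ → ℝ) (x₀ x : EuclideanSpace ℝ (Fin 2)) (ε : ℝ) (i : ℤ × ℤ) : ℝ :=
  hilbertTransform (deriv φ)
    ((inner ℝ (unitVec (angle κ ε i.1)) x₀ - pbar) / ε - i.2
      + inner ℝ (unitVec (angle κ ε i.1)) x)

/-- The sum of the third absolute moments: `∑ |H φ'|³ E|η|³`. -/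
def thirdMomentSum {Ω : Type*} [MeasurableSpace Ω] (μ : Measure Ω) (κ pbar P : ℝ) (φ : ℝ → ℝ)
    (η : ℝ → ℤ → ℤ → Ω → ℝ) (x₀ x : EuclideanSpace ℝ (Fin 2)) (ε : ℝ) : ℝ :=
  ∑ i ∈ grid κ pbar P ε,
    |weight κ pbar φ x₀ x ε i| ^ 3 * ∫ ω, |η ε i.1 i.2 ω| ^ 3 ∂μ

/-- The sum of the variances: `∑ (H φ')² E η²`. -/
def varianceSum {Ω : Type*} [MeasurableSpace Ω] (μ : Measure Ω) (κ pbar P : ℝ) (φ : ℝ → ℝ)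
    (η : ℝ → ℤ → ℤ → Ω → ℝ) (x₀ x : EuclideanSpace ℝ (Fin 2)) (ε : ℝ) : ℝ :=
  ∑ i ∈ grid κ pbar P ε,
    (weight κ pbar φ x₀ x ε i) ^ 2 * ∫ ω, (η ε i.1 i.2 ω) ^ 2 ∂μ

end

end NoisyFBP

/-!
The Hilbert transform of `φ'` is continuous and, because `∫ φ' = 0` and `∫ s φ'(s) ds = -1`, it
decays exactly like `-1 / (π t²)` (`tendsto_sq_mul_hilbertTransform_deriv`). Hence its square is
integrable with positive integral, and sums of its powers over shifted integers are bounded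
uniformly in the shift. This already bounds the sum of the third moments by a constant times
`(Δα)^(3/2)` per direction, that is, by `O(ε^(1/2))` altogether (`thirdMomentSum_isBigO`); the ratio
is then controlled as soon as the variance sum has a positive limit.

For the variance sum, only the offsets `p_j` at distance `O(ε)` from the line through the centre
matter, so `σ²(α_k, p_j)` may be replaced by `g(α_k) = σ²(α_k, α⃗_k · x₀)`, and the sum over `j` by
the full periodization `Ψ` of `(H φ')²`, evaluated at the phase
`u_k = (α⃗_k · x₀ - pbar) / ε + α⃗_k · x` (`tendsto_grid_sum_sub`). What remains is
`∑_k Δα g(α_k) Ψ(u_k)`, and the claim is that `u_k` is equidistributed modulo one, so that this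
tends to `∫ g · ∫₀¹ Ψ = ∫ g · ∫ (H φ')²`.

Equidistribution is tested on the characters of the circle, whose span is dense in the continuous
functions (`tendsto_sum_comp_addCircle`). For a nonzero frequency `m`, the sum is averaged over
blocks of `L` consecutive indices. On a block the phase is nearly linear, with slope
`β(α) = κ d/dα (α⃗ · x₀)`, so the block contributes the mean of a geometric progression of ratio
`exp(2πi m β(α))`. As `ε → 0` the modulus of the whole sum is thus asymptotically at most
`∫ |g(α)| |L⁻¹ ∑_{l < L} exp(2πi m l β(α))| dα` (`tendsto_integral_block_average`), and this tends
to `0` as `L → ∞` by dominated convergence, because `m β(α)` is an integer only for countably many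
`α` when `x₀ ≠ 0`; the centre is nonzero because `κ |x₀|` is irrational.

All passages from Riemann sums to integrals are instances of dominated convergence, the sum over `k`
being written as the integral of the step function `α ↦ F ⌊α / Δα⌋`
(`tendsto_integral_comp_floor_div`).
-/

open MeasureTheory ProbabilityTheory Filter Topology

namespace NoisyFBP

/-! ### The Hilbert transform of a compactly supported function -/

/-- The truncated principal-value integral, folded onto the half-line `r > δ` by `s = t ∓ r`. -/
theorem integral_truncated_kernel {f : ℝ → ℝ} (hc : Continuous f) (hs : HasCompactSupport f)
    (t : ℝ) {δ : ℝ} (hδ : 0 < δ) :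
    ∫ s in {s : ℝ | δ < |t - s|}, f s / (t - s)
      = ∫ r in Set.Ioi δ, (f (t - r) - f (t + r)) / r := by
  have hfi : Integrable f := hc.integrable_of_hasCompactSupport hs
  have hmS : MeasurableSet {s : ℝ | δ < |t - s|} :=
    measurableSet_lt measurable_const (by fun_prop)
  have hmr : MeasurableSet {r : ℝ | δ < |r|} := measurableSet_lt measurable_const (by fun_prop)
  have hsub : ∫ s in {s : ℝ | δ < |t - s|}, f s / (t - s)
      = ∫ r in {r : ℝ | δ < |r|}, f (t - r) / r := by
    rw [← integral_indicator hmS, ← integral_indicator hmr,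
      ← integral_sub_left_eq_self (fun s => Set.indicator {s : ℝ | δ < |t - s|}
        (fun s => f s / (t - s)) s) volume t]
    refine integral_congr_ae (Eventually.of_forall fun r => ?_)
    simp only [Set.indicator_apply, Set.mem_ofPred_eq, sub_sub_cancel]
  have hset : {r : ℝ | δ < |r|} = Set.Ioi δ ∪ Set.Iio (-δ) := by
    ext r
    simp only [Set.mem_ofPred_eq, Set.mem_union, Set.mem_Ioi, Set.mem_Iio, lt_abs]
    constructor <;> rintro (h | h) <;> [left; right; left; right] <;> linarith
  have key : ∀ g : ℝ → ℝ, Integrable g → Measurable g →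
      IntegrableOn (fun r => g r / r) {r : ℝ | δ < |r|} := by
    intro g hg hgm
    refine Integrable.mono' (g := fun r => |g r| / δ) (hg.abs.div_const δ).integrableOn
      (hgm.div measurable_id).aestronglyMeasurable ?_
    refine (ae_restrict_iff' hmr).2 (Eventually.of_forall fun r hr => ?_)
    rw [Real.norm_eq_abs, abs_div]
    exact div_le_div_of_nonneg_left (abs_nonneg _) hδ (le_of_lt hr)
  have hm : Measurable f := hc.measurable
  have h1 : Integrable fun r => f (t - r) := hfi.comp_sub_left t
  have h2 : Integrable fun r => f (t + r) := hfi.comp_add_left t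
  have i1 := key _ h1 (by fun_prop)
  have i2 := key _ h2 (by fun_prop)
  rw [hset] at i1 i2
  rw [hsub, hset, setIntegral_union (by
      rw [Set.disjoint_left]; intro r hr hr'
      simp only [Set.mem_Ioi, Set.mem_Iio] at hr hr'; linarith) measurableSet_Iio
      (i1.mono_set Set.subset_union_left) (i1.mono_set Set.subset_union_right),
    ← integral_Iic_eq_integral_Iio, ← integral_comp_neg_Ioi, ← integral_add]
  · refine integral_congr_ae (Eventually.of_forall fun r => ?_)
    simp only [sub_neg_eq_add, div_neg]
    ring
  · exact i1.mono_set Set.subset_union_left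
  · have := (i2.mono_set Set.subset_union_left).neg
    refine this.congr (Eventually.of_forall fun r => ?_)
    simp [div_neg]

/-- On the half-line, the folded kernel is bounded by twice the Lipschitz constant, and it vanishes
far out, uniformly for `t` in bounded sets. -/
theorem norm_folded_kernel_le {f : ℝ → ℝ} {C R T t r : ℝ}
    (hL : ∀ x y, |f x - f y| ≤ C * |x - y|) (hR : ∀ x, R ≤ |x| → f x = 0)
    (ht : |t| ≤ T) (hr : 0 < r) :
    ‖(f (t - r) - f (t + r)) / r‖ ≤ Set.indicator (Set.Ioc 0 (R + T)) (fun _ => 2 * C) r := by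
  by_cases h : r ≤ R + T
  · rw [Set.indicator_of_mem (Set.mem_Ioc.2 ⟨hr, h⟩), Real.norm_eq_abs, abs_div, abs_of_pos hr,
      div_le_iff₀ hr]
    refine (hL _ _).trans (le_of_eq ?_)
    have : t - r - (t + r) = -(2 * r) := by ring
    rw [this, abs_neg, abs_of_pos (by linarith)]
    ring
  · push Not at h
    have ht' := abs_le.1 ht
    rw [Set.indicator_of_notMem (fun h' => absurd h'.2 (not_le.2 h)), hR, hR]
    · simp
    · exact le_trans (by linarith) (le_abs_self _)
    · exact le_trans (by linarith) (neg_le_abs _)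

theorem hilbertTransform_eq_integral {f : ℝ → ℝ} (hf : ContDiff ℝ 1 f) (hs : HasCompactSupport f)
    (t : ℝ) :
    hilbertTransform f t
      = (1 / Real.pi) * ∫ r in Set.Ioi (0 : ℝ), (f (t - r) - f (t + r)) / r := by
  obtain ⟨C, hC⟩ := hf.lipschitzWith_of_hasCompactSupport hs one_ne_zero
  obtain ⟨R, -, hR⟩ := hs.exists_pos_le_norm
  have hL : ∀ x y, |f x - f y| ≤ C * |x - y| := fun x y => by
    simpa [Real.dist_eq] using hC.dist_le_mul x y
  have hm : Measurable f := hf.continuous.measurable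
  have hlim : Tendsto (fun δ : ℝ => ∫ r in Set.Ioi δ, (f (t - r) - f (t + r)) / r) (𝓝[>] 0)
      (𝓝 (∫ r in Set.Ioi (0 : ℝ), (f (t - r) - f (t + r)) / r)) := by
    have hind : ∀ δ : ℝ, ∫ r in Set.Ioi δ, (f (t - r) - f (t + r)) / r
        = ∫ r, Set.indicator (Set.Ioi δ) (fun r => (f (t - r) - f (t + r)) / r) r :=
      fun δ => (integral_indicator measurableSet_Ioi).symm
    simp_rw [hind]
    refine tendsto_integral_filter_of_dominated_convergence
      (Set.indicator (Set.Ioc 0 (R + |t|)) (fun _ => 2 * (C : ℝ))) ?_ ?_ ?_ ?_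
    · refine Eventually.of_forall fun δ => Measurable.aestronglyMeasurable ?_
      exact Measurable.indicator (by fun_prop) measurableSet_Ioi
    · filter_upwards [self_mem_nhdsWithin] with δ hδ
      refine Eventually.of_forall fun r => ?_
      by_cases hr : r ∈ Set.Ioi δ
      · rw [Set.indicator_of_mem hr]
        exact norm_folded_kernel_le hL hR le_rfl (lt_trans hδ hr)
      · rw [Set.indicator_of_notMem hr, norm_zero]
        exact Set.indicator_nonneg (fun _ _ => by positivity) _
    · exact (integrable_indicator_iff measurableSet_Ioc).2 (integrableOn_const (by simp))
    · refine Eventually.of_forall fun r => ?_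
      by_cases hr : 0 < r
      · refine Tendsto.congr' ?_ tendsto_const_nhds
        filter_upwards [mem_nhdsWithin_of_mem_nhds (Iio_mem_nhds hr)] with δ hδ
        rw [Set.indicator_of_mem (show r ∈ Set.Ioi δ from hδ),
          Set.indicator_of_mem (show r ∈ Set.Ioi 0 from hr)]
      · refine Tendsto.congr' ?_ tendsto_const_nhds
        filter_upwards [self_mem_nhdsWithin] with δ hδ
        have h0 : (0 : ℝ) < δ := hδ
        rw [Set.indicator_of_notMem (show r ∉ Set.Ioi δ by simp; linarith),
          Set.indicator_of_notMem (show r ∉ Set.Ioi 0 from hr)]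
  refine Tendsto.limUnder_eq (Tendsto.const_mul _ (hlim.congr' ?_))
  filter_upwards [self_mem_nhdsWithin] with δ hδ
  exact (integral_truncated_kernel hf.continuous hs t hδ).symm

theorem continuous_hilbertTransform {f : ℝ → ℝ} (hf : ContDiff ℝ 1 f) (hs : HasCompactSupport f) :
    Continuous (hilbertTransform f) := by
  obtain ⟨C, hC⟩ := hf.lipschitzWith_of_hasCompactSupport hs one_ne_zero
  obtain ⟨R, -, hR⟩ := hs.exists_pos_le_norm
  have hL : ∀ x y, |f x - f y| ≤ C * |x - y| := fun x y => by
    simpa [Real.dist_eq] using hC.dist_le_mul x y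
  have hc : Continuous f := hf.continuous
  rw [funext (hilbertTransform_eq_integral hf hs)]
  refine continuous_const.mul (continuous_iff_continuousAt.2 fun t₀ => ?_)
  refine continuousAt_of_dominated
    (bound := Set.indicator (Set.Ioc 0 (R + (|t₀| + 1))) (fun _ => 2 * (C : ℝ))) ?_ ?_ ?_ ?_
  · have hm := hc.measurable
    exact Eventually.of_forall fun t => Measurable.aestronglyMeasurable (by fun_prop)
  · have : ∀ᶠ t : ℝ in 𝓝 t₀, |t| < |t₀| + 1 :=
      continuous_abs.continuousAt.eventually_lt_const (by linarith)
    filter_upwards [this] with t ht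
    exact (ae_restrict_iff' measurableSet_Ioi).2
      (Eventually.of_forall fun r hr => norm_folded_kernel_le hL hR ht.le hr)
  · exact ((integrable_indicator_iff measurableSet_Ioc).2
      (integrableOn_const (by simp))).integrableOn
  · exact Eventually.of_forall fun r => by fun_prop

/-- Away from the support the principal value is an ordinary integral. -/
theorem hilbertTransform_eq_of_support {f : ℝ → ℝ} {R t : ℝ}
    (hR : ∀ x, R ≤ |x| → f x = 0) (ht : R < |t|) :
    hilbertTransform f t = (1 / Real.pi) * ∫ s, f s / (t - s) := by
  refine Tendsto.limUnder_eq (Tendsto.congr' ?_ tendsto_const_nhds)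
  filter_upwards [mem_nhdsWithin_of_mem_nhds (Iio_mem_nhds (sub_pos.2 ht))] with δ hδ
  have hδ' : δ < |t| - R := hδ
  rw [setIntegral_eq_integral_of_forall_compl_eq_zero]
  intro s hs
  have hs' : |t - s| ≤ δ := not_lt.1 hs
  have := abs_sub_abs_le_abs_sub t s
  rw [hR s (by linarith), zero_div]

/-- If `φ` has integral `1`, then `H φ'` decays exactly like `-1 / (π t²)`: the leading term
`1 / t` of the kernel is killed by `∫ φ' = 0`, and the next term gives `∫ s φ'(s) ds = -1`. -/
theorem tendsto_sq_mul_hilbertTransform_deriv {φ : ℝ → ℝ} (hφ : ContDiff ℝ 1 φ)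
    (hs : HasCompactSupport φ) (h1 : ∫ t, φ t = 1) :
    Tendsto (fun t : ℝ => t ^ 2 * hilbertTransform (deriv φ) t) (cocompact ℝ)
      (𝓝 (-(1 / Real.pi))) := by
  have hdc : Continuous (deriv φ) := hφ.continuous_deriv le_rfl
  have hds : HasCompactSupport (deriv φ) := hs.deriv
  have hdi : Integrable (deriv φ) := hdc.integrable_of_hasCompactSupport hds
  obtain ⟨R, hR0, hR⟩ := hds.exists_pos_le_norm
  have hder : ∀ x, HasDerivAt φ (deriv φ x) x := fun x =>
    (hφ.differentiable one_ne_zero x).hasDerivAt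
  have hφi : Integrable φ := hφ.continuous.integrable_of_hasCompactSupport hs
  have hzero : ∫ s, deriv φ s = 0 := integral_eq_zero_of_hasDerivAt_of_integrable hder hdi hφi
  have hxi : Integrable fun s => s * deriv φ s :=
    (continuous_id.mul hdc).integrable_of_hasCompactSupport hds.mul_left
  have hfirst : ∫ s, s * deriv φ s = -1 := by
    have := integral_mul_deriv_eq_deriv_mul_of_integrable (u := fun s : ℝ => s) (v := φ)
      (u' := fun _ => 1) (v' := deriv φ) (fun x _ => hasDerivAt_id x) (fun x _ => hder x) hxi
      (by simpa [Pi.mul_def] using hφi)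
      ((continuous_id.mul hφ.continuous).integrable_of_hasCompactSupport hs.mul_left)
    rw [this]; simp [h1]
  have hlarge : ∀ᶠ t : ℝ in cocompact ℝ, 2 * R < |t| :=
    tendsto_norm_cocompact_atTop.eventually_gt_atTop (2 * R)
  have hrat : ∀ s : ℝ, Tendsto (fun t : ℝ => t / (t - s)) (cocompact ℝ) (𝓝 1) := by
    intro s
    have hinv : Tendsto (fun t : ℝ => s * t⁻¹) (cocompact ℝ) (𝓝 0) := by
      simpa [Metric.cobounded_eq_cocompact] using (tendsto_inv₀_cobounded (α := ℝ)).const_mul s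
    have : Tendsto (fun t : ℝ => (1 - s * t⁻¹)⁻¹) (cocompact ℝ) (𝓝 1) := by
      simpa using (hinv.const_sub 1).inv₀ (by simp)
    refine this.congr' ?_
    filter_upwards [hlarge] with t ht
    have ht0 : t ≠ 0 := by rintro rfl; simp at ht; linarith
    rw [← one_div, ← div_eq_mul_inv, one_sub_div ht0, one_div_div]
  have : (cocompact ℝ).IsCountablyGenerated := by
    rw [← Metric.cobounded_eq_cocompact, ← comap_norm_atTop]
    infer_instance
  have hlim : Tendsto (fun t : ℝ => ∫ s, s * deriv φ s * (t / (t - s))) (cocompact ℝ)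
      (𝓝 (∫ s, s * deriv φ s)) := by
    refine tendsto_integral_filter_of_dominated_convergence (fun s => |s * deriv φ s| * 2)
      ?_ ?_ (hxi.abs.mul_const 2) ?_
    · have := hdc.measurable
      exact Eventually.of_forall fun t => Measurable.aestronglyMeasurable (by fun_prop)
    · filter_upwards [hlarge] with t ht
      refine Eventually.of_forall fun s => ?_
      by_cases hsR : R ≤ |s|
      · simp [hR s hsR]
      · push Not at hsR
        have h2 := abs_sub_abs_le_abs_sub t s
        have h3 : 0 < |t - s| := by linarith
        rw [norm_mul, Real.norm_eq_abs, Real.norm_eq_abs, abs_div]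
        refine mul_le_mul_of_nonneg_left ?_ (abs_nonneg _)
        rw [div_le_iff₀ h3]
        linarith
    · refine Eventually.of_forall fun s => ?_
      simpa using (hrat s).const_mul (s * deriv φ s)
  have := (hlim.const_mul (1 / Real.pi))
  rw [hfirst, mul_neg_one] at this
  refine this.congr' ?_
  filter_upwards [hlarge] with t ht
  have hR' : ∀ x, R ≤ |x| → deriv φ x = 0 := hR
  have hRt : R < |t| := by linarith
  rw [hilbertTransform_eq_of_support hR' hRt, mul_left_comm]
  congr 1
  have : ∀ s, t ^ 2 * (deriv φ s / (t - s)) = t * deriv φ s + s * deriv φ s * (t / (t - s)) := by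
    intro s
    by_cases hts : t - s = 0
    · rw [show deriv φ s = 0 from hR' s (by rw [← sub_eq_zero.1 hts]; exact hRt.le)]
      simp
    · field_simp
      ring
  rw [← integral_const_mul]
  simp_rw [this]
  rw [integral_add (hdi.const_mul t), integral_const_mul, hzero, mul_zero, zero_add]
  have hi : Integrable fun s => t ^ 2 * (deriv φ s / (t - s)) - t * deriv φ s := by
    refine Integrable.sub (Integrable.const_mul ?_ _) (hdi.const_mul t)
    refine Integrable.mono' (hdi.abs.div_const (|t| - R))
      (hdc.measurable.div (by fun_prop)).aestronglyMeasurable (Eventually.of_forall fun s => ?_)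
    by_cases hsR : R ≤ |s|
    · simp [hR' s hsR]
    · push Not at hsR
      have h2 := abs_sub_abs_le_abs_sub t s
      rw [Real.norm_eq_abs, abs_div]
      exact div_le_div_of_nonneg_left (abs_nonneg _) (by linarith) (by linarith)
  refine hi.congr (Eventually.of_forall fun s => ?_)
  simp only [this s]
  ring

theorem contDiff_one_deriv {φ : ℝ → ℝ} (hφ : ContDiff ℝ 2 φ) : ContDiff ℝ 1 (deriv φ) := by
  rw [← one_add_one_eq_two] at hφ
  exact hφ.deriv'

theorem exists_hilbertTransform_deriv_bound {φ : ℝ → ℝ} (hφ : ContDiff ℝ 2 φ)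
    (hs : HasCompactSupport φ) (h1 : ∫ t, φ t = 1) :
    ∃ K : ℝ, ∀ t, |hilbertTransform (deriv φ) t| ≤ K / (1 + t ^ 2) := by
  have hc : Continuous (hilbertTransform (deriv φ)) :=
    continuous_hilbertTransform (contDiff_one_deriv hφ) hs.deriv
  have hlim := tendsto_sq_mul_hilbertTransform_deriv (hφ.of_le one_le_two) hs h1
  have h1' : ∀ᶠ t in cocompact ℝ, |t ^ 2 * hilbertTransform (deriv φ) t| < 1 / Real.pi + 1 := by
    refine hlim.abs.eventually_lt_const ?_
    rw [abs_neg, abs_of_pos (by positivity)]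
    linarith
  obtain ⟨S, hS, hS'⟩ := mem_cocompact.1
    (h1'.and (tendsto_norm_cocompact_atTop.eventually_gt_atTop (1 : ℝ)))
  obtain ⟨B, hB⟩ := hS.exists_bound_of_continuousOn
    (f := fun t => (1 + t ^ 2) * hilbertTransform (deriv φ) t) (by fun_prop)
  refine ⟨max B (2 * (1 / Real.pi + 1)), fun t => ?_⟩
  have hp : 0 < 1 + t ^ 2 := by positivity
  rw [le_div_iff₀ hp, mul_comm, ← abs_of_pos hp, ← abs_mul]
  by_cases ht : t ∈ S
  · exact (hB t ht).trans (le_max_left _ _)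
  · obtain ⟨h2, h3⟩ := hS' ht
    refine le_trans ?_ (le_max_right _ _)
    have h4 : 1 ≤ t ^ 2 := by
      rw [Real.norm_eq_abs] at h3
      rw [← sq_abs]; nlinarith
    rw [abs_mul, abs_of_pos (by positivity)] at h2
    rw [abs_mul, abs_of_pos hp]
    nlinarith [abs_nonneg (hilbertTransform (deriv φ) t)]

theorem integral_sq_hilbertTransform_deriv_pos {φ : ℝ → ℝ} (hφ : ContDiff ℝ 2 φ)
    (hs : HasCompactSupport φ) (h1 : ∫ t, φ t = 1)
    (hi : Integrable fun r => hilbertTransform (deriv φ) r ^ 2) :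
    0 < ∫ r, hilbertTransform (deriv φ) r ^ 2 := by
  have hc : Continuous (hilbertTransform (deriv φ)) :=
    continuous_hilbertTransform (contDiff_one_deriv hφ) hs.deriv
  have hlim := tendsto_sq_mul_hilbertTransform_deriv (hφ.of_le one_le_two) hs h1
  have hneg : -(1 / Real.pi) < 0 := by simpa using Real.pi_pos
  obtain ⟨t, ht⟩ := (hlim.eventually_lt_const hneg).exists
  rw [integral_pos_iff_support_of_nonneg (fun r => sq_nonneg _) hi]
  refine ((hc.pow 2).isOpen_support).measure_pos _ ⟨t, ?_⟩
  intro h0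
  have h0' : hilbertTransform (deriv φ) t = 0 := pow_eq_zero_iff two_ne_zero |>.1 h0
  simp [h0'] at ht

/-! ### Riemann sums as integrals of step functions -/

/-- The indices `k` with `|k κ ε| ≤ π`. -/
noncomputable def angleWindow (κ ε : ℝ) : Finset ℤ :=
  Finset.Icc ⌈-Real.pi / (κ * ε)⌉ ⌊Real.pi / (κ * ε)⌋

theorem mem_angleWindow {κ ε : ℝ} (h : 0 < κ * ε) (k : ℤ) :
    k ∈ angleWindow κ ε ↔ |angle κ ε k| ≤ Real.pi := by
  simp only [angleWindow, angle, Finset.mem_Icc, Int.ceil_le, Int.le_floor, abs_le,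
    div_le_iff₀ h, le_div_iff₀ h]

section Step

variable {E : Type*} [NormedAddCommGroup E]

theorem comp_floor_div_eq_sum {Δ : ℝ} (hΔ : 0 < Δ) (G : ℤ → E) (S : Finset ℤ)
    (hG : ∀ k ∉ S, G k = 0) (α : ℝ) :
    G ⌊α / Δ⌋ = ∑ k ∈ S, Set.indicator (Set.Ico (k * Δ) ((k + 1) * Δ)) (fun _ => G k) α := by
  have hmem : ∀ k : ℤ, α ∈ Set.Ico (k * Δ) ((k + 1) * Δ) ↔ ⌊α / Δ⌋ = k := by
    intro k
    rw [Int.floor_eq_iff, le_div_iff₀ hΔ, div_lt_iff₀ hΔ, Set.mem_Ico]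
  have : ∀ k ∈ S, Set.indicator (Set.Ico (k * Δ) ((k + 1) * Δ)) (fun _ => G k) α
      = if ⌊α / Δ⌋ = k then G k else 0 := by
    intro k _
    simp only [Set.indicator_apply, hmem]
  rw [Finset.sum_congr rfl this, Finset.sum_ite_eq]
  split_ifs with h
  · rfl
  · exact hG _ h

theorem integrable_comp_floor_div {Δ : ℝ} (hΔ : 0 < Δ) (G : ℤ → E) (S : Finset ℤ)
    (hG : ∀ k ∉ S, G k = 0) : Integrable fun α : ℝ => G ⌊α / Δ⌋ := by
  simp_rw [comp_floor_div_eq_sum hΔ G S hG]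
  exact integrable_finsetSum _ fun k _ =>
    (integrable_indicator_iff measurableSet_Ico).2 (integrableOn_const (by simp))

variable [NormedSpace ℝ E]

theorem integral_comp_floor_div [CompleteSpace E] {Δ : ℝ} (hΔ : 0 < Δ) (G : ℤ → E) (S : Finset ℤ)
    (hG : ∀ k ∉ S, G k = 0) : ∫ α : ℝ, G ⌊α / Δ⌋ = Δ • ∑ k ∈ S, G k := by
  simp_rw [comp_floor_div_eq_sum hΔ G S hG]
  rw [integral_finsetSum _ fun k _ =>
    (integrable_indicator_iff measurableSet_Ico).2 (integrableOn_const (by simp)),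
    Finset.smul_sum]
  refine Finset.sum_congr rfl fun k _ => ?_
  rw [integral_indicator measurableSet_Ico, setIntegral_const, Real.volume_real_Ico_of_le]
  · congr 1; ring
  · nlinarith

theorem eventually_mul_lt_one (κ : ℝ) : ∀ᶠ ε : ℝ in 𝓝[>] 0, κ * ε < 1 := by
  have : Tendsto (fun ε : ℝ => κ * ε) (𝓝[>] 0) (𝓝 0) := by
    simpa using (tendsto_nhdsWithin_of_tendsto_nhds (tendsto_id (x := 𝓝 (0 : ℝ)))).const_mul κ
  exact this.eventually_lt_const one_pos

theorem tendsto_mul_floor_div {κ : ℝ} (hκ : 0 < κ) (α : ℝ) (l : ℤ) :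
    Tendsto (fun ε : ℝ => angle κ ε (⌊α / (κ * ε)⌋ + l)) (𝓝[>] 0) (𝓝 α) := by
  have hid : Tendsto (fun ε : ℝ => ε) (𝓝[>] 0) (𝓝 0) :=
    tendsto_nhdsWithin_of_tendsto_nhds tendsto_id
  have h0 : Tendsto (fun ε : ℝ => α + (l : ℝ) * (κ * ε)) (𝓝[>] 0) (𝓝 α) := by
    simpa using ((hid.const_mul κ).const_mul (l : ℝ)).const_add α
  have h1 : Tendsto (fun ε : ℝ => α + (l - 1 : ℝ) * (κ * ε)) (𝓝[>] 0) (𝓝 α) := by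
    simpa using ((hid.const_mul κ).const_mul (l - 1 : ℝ)).const_add α
  refine tendsto_of_tendsto_of_tendsto_of_le_of_le' h1 h0 ?_ ?_
  all_goals
    filter_upwards [self_mem_nhdsWithin] with ε hε
    have hp : 0 < κ * ε := mul_pos hκ hε
    have hfl := Int.floor_le (α / (κ * ε))
    have hlt := Int.lt_floor_add_one (α / (κ * ε))
    rw [le_div_iff₀ hp] at hfl
    rw [div_lt_iff₀ hp] at hlt
    simp only [angle]
    push_cast
    nlinarith

/-- Dominated convergence for Riemann sums whose summands depend on the step size. -/
theorem tendsto_integral_comp_floor_div {κ : ℝ} (hκ : 0 < κ) {G : ℝ → ℤ → E} {f : ℝ → E} {C B : ℝ}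
    (hsupp : ∀ᶠ ε : ℝ in 𝓝[>] 0, ∀ k, G ε k ≠ 0 → |angle κ ε k| ≤ B)
    (hC : ∀ᶠ ε : ℝ in 𝓝[>] 0, ∀ k, ‖G ε k‖ ≤ C)
    (hlim : ∀ᵐ α : ℝ, Tendsto (fun ε => G ε ⌊α / (κ * ε)⌋) (𝓝[>] 0) (𝓝 (f α))) :
    Tendsto (fun ε => ∫ α : ℝ, G ε ⌊α / (κ * ε)⌋) (𝓝[>] 0) (𝓝 (∫ α, f α)) := by
  refine tendsto_integral_filter_of_dominated_convergence
    (Set.indicator (Set.Icc (-(B + 1)) (B + 1)) fun _ => C) ?_ ?_ ?_ hlim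
  · refine Eventually.of_forall fun ε => ?_
    have hm : Measurable fun α : ℝ => ⌊α / (κ * ε)⌋ := (measurable_id.div_const _).floor
    exact ((StronglyMeasurable.of_discrete (f := G ε)).comp_measurable hm).aestronglyMeasurable
  · filter_upwards [hsupp, hC, eventually_mul_lt_one κ, self_mem_nhdsWithin] with ε h1 h2 h3 hε
    refine Eventually.of_forall fun α => ?_
    have hp : 0 < κ * ε := mul_pos hκ hε
    by_cases h0 : G ε ⌊α / (κ * ε)⌋ = 0
    · rw [h0, norm_zero]
      exact Set.indicator_nonneg (fun _ _ => (norm_nonneg _).trans (h2 0)) _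
    · have h4 := abs_le.1 (h1 _ h0)
      have hfl := Int.floor_le (α / (κ * ε))
      have hlt := Int.lt_floor_add_one (α / (κ * ε))
      rw [le_div_iff₀ hp] at hfl
      rw [div_lt_iff₀ hp] at hlt
      simp only [angle] at h4
      rw [Set.indicator_of_mem]
      · exact h2 _
      · constructor <;> nlinarith
  · exact (integrable_indicator_iff measurableSet_Icc).2 (integrableOn_const (by simp))

theorem eventually_mem_angleWindow {κ : ℝ} (hκ : 0 < κ) {α : ℝ}
    (hα : α ∈ Set.Ioo (-Real.pi) Real.pi) (l : ℤ) :
    ∀ᶠ ε : ℝ in 𝓝[>] 0, ⌊α / (κ * ε)⌋ + l ∈ angleWindow κ ε := by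
  filter_upwards [(tendsto_mul_floor_div hκ α l).eventually_mem (Ioo_mem_nhds hα.1 hα.2),
    self_mem_nhdsWithin] with ε h hε
  rw [mem_angleWindow (mul_pos hκ hε), abs_le]
  exact ⟨h.1.le, h.2.le⟩

theorem eventually_notMem_angleWindow {κ : ℝ} (hκ : 0 < κ) {α : ℝ}
    (hα : α ∉ Set.Icc (-Real.pi) Real.pi) (l : ℤ) :
    ∀ᶠ ε : ℝ in 𝓝[>] 0, ⌊α / (κ * ε)⌋ + l ∉ angleWindow κ ε := by
  filter_upwards [(tendsto_mul_floor_div hκ α l).eventually_mem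
    (isClosed_Icc.isOpen_compl.mem_nhds hα), self_mem_nhdsWithin] with ε h hε
  rw [mem_angleWindow (mul_pos hκ hε), abs_le]
  exact h

theorem tendsto_smul_sum_angleWindow [CompleteSpace E] {κ : ℝ} (hκ : 0 < κ) {F : ℝ → ℤ → E}
    {f : ℝ → E} {C : ℝ} (hC : ∀ᶠ ε : ℝ in 𝓝[>] 0, ∀ k ∈ angleWindow κ ε, ‖F ε k‖ ≤ C)
    (hlim : ∀ᵐ α : ℝ, α ∈ Set.Ioo (-Real.pi) Real.pi →
      Tendsto (fun ε => F ε ⌊α / (κ * ε)⌋) (𝓝[>] 0) (𝓝 (f α))) :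
    Tendsto (fun ε => (κ * ε) • ∑ k ∈ angleWindow κ ε, F ε k) (𝓝[>] 0)
      (𝓝 (∫ α in (-Real.pi)..Real.pi, f α)) := by
  classical
  have hpi := Real.pi_pos
  have key := tendsto_integral_comp_floor_div (E := E) hκ
    (G := fun ε k => if k ∈ angleWindow κ ε then F ε k else 0)
    (f := Set.indicator (Set.Ioc (-Real.pi) Real.pi) f) (C := |C|) (B := Real.pi) ?_ ?_ ?_
  · rw [integral_indicator measurableSet_Ioc,
      ← intervalIntegral.integral_of_le (by linarith)] at key
    refine key.congr' ?_
    filter_upwards [self_mem_nhdsWithin] with ε hε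
    rw [integral_comp_floor_div (mul_pos hκ hε)
      (fun k => if k ∈ angleWindow κ ε then F ε k else 0) (angleWindow κ ε)
      (fun k hk => if_neg hk)]
    congr 1
    exact Finset.sum_congr rfl fun k hk => if_pos hk
  · filter_upwards [self_mem_nhdsWithin] with ε hε k hk
    rw [← mem_angleWindow (mul_pos hκ hε)]
    by_contra h
    exact hk (if_neg h)
  · filter_upwards [hC] with ε h k
    split_ifs with hk
    · exact (h k hk).trans (le_abs_self C)
    · simp
  · have hne : ∀ᵐ α : ℝ, α ≠ Real.pi ∧ α ≠ -Real.pi := by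
      refine Eventually.and ?_ ?_ <;> exact Measure.ae_ne volume _
    filter_upwards [hlim, hne] with α h hα
    by_cases hm : α ∈ Set.Ioo (-Real.pi) Real.pi
    · rw [Set.indicator_of_mem (Set.Ioo_subset_Ioc_self hm)]
      refine (h hm).congr' ?_
      filter_upwards [eventually_mem_angleWindow hκ hm 0] with ε hε
      rw [add_zero] at hε
      rw [if_pos hε]
    · have hm' : α ∉ Set.Icc (-Real.pi) Real.pi := fun hc =>
        hm ⟨lt_of_le_of_ne hc.1 hα.2.symm, lt_of_le_of_ne hc.2 hα.1⟩
      rw [Set.indicator_of_notMem fun hc => hm' (Set.Ioc_subset_Icc_self hc)]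
      refine tendsto_const_nhds.congr' ?_
      filter_upwards [eventually_notMem_angleWindow hκ hm' 0] with ε hε
      rw [add_zero] at hε
      rw [if_neg hε]

/-- Averaging over shifts: the sum of `G` equals the sum of the averages of `G` over `L`
consecutive indices. -/
theorem norm_integral_comp_floor_div_le {Δ : ℝ} (hΔ : 0 < Δ) (G : ℤ → E) (S : Finset ℤ)
    (hG : ∀ k ∉ S, G k = 0) {L : ℕ} (hL : L ≠ 0) :
    ‖∫ α : ℝ, G ⌊α / Δ⌋‖
      ≤ ∫ α : ℝ, ‖(L : ℝ)⁻¹ • ∑ l ∈ Finset.range L, G (⌊α / Δ⌋ + l)‖ := by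
  have hfl : ∀ (α : ℝ) (l : ℕ), ⌊(α + l * Δ) / Δ⌋ = ⌊α / Δ⌋ + l := by
    intro α l
    rw [add_div, mul_div_cancel_right₀ _ hΔ.ne', Int.floor_add_natCast]
  have hshift : ∀ l : ℕ, ∫ α : ℝ, G (⌊α / Δ⌋ + l) = ∫ α : ℝ, G ⌊α / Δ⌋ := by
    intro l
    rw [← integral_add_right_eq_self (fun α : ℝ => G ⌊α / Δ⌋) ((l : ℝ) * Δ)]
    simp_rw [hfl]
  have hint : ∀ l : ℕ, Integrable fun α : ℝ => G (⌊α / Δ⌋ + l) := by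
    intro l
    have := (integrable_comp_floor_div hΔ G S hG).comp_add_right ((l : ℝ) * Δ)
    simpa only [hfl] using this
  have : ∫ α : ℝ, G ⌊α / Δ⌋
      = ∫ α : ℝ, (L : ℝ)⁻¹ • ∑ l ∈ Finset.range L, G (⌊α / Δ⌋ + l) := by
    rw [integral_smul, integral_finsetSum _ fun l _ => hint l]
    simp_rw [hshift]
    rw [Finset.sum_const, Finset.card_range, ← Nat.cast_smul_eq_nsmul ℝ, smul_smul,
      inv_mul_cancel₀ (by exact_mod_cast hL), one_smul]
  rw [this]
  exact norm_integral_le_integral_norm _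

end Step

/-! ### Equidistribution of a slowly varying phase -/

theorem fourier_coe_add (m : ℤ) (a b : ℝ) :
    fourier m ((a + b : ℝ) : AddCircle (1 : ℝ))
      = fourier m (a : AddCircle (1 : ℝ)) * fourier m (b : AddCircle (1 : ℝ)) := by
  simp only [fourier_coe_apply, ← Complex.exp_add]
  congr 1
  push_cast
  ring

theorem fourier_coe_nat_mul (m : ℤ) (l : ℕ) (b : ℝ) :
    fourier m ((l * b : ℝ) : AddCircle (1 : ℝ)) = fourier m (b : AddCircle (1 : ℝ)) ^ l := by
  simp only [fourier_coe_apply, ← Complex.exp_nat_mul]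
  congr 1
  push_cast
  ring

theorem norm_fourier_coe (m : ℤ) (a : AddCircle (1 : ℝ)) : ‖fourier m a‖ = 1 := by
  rw [fourier_apply, Circle.norm_coe]

theorem fourier_coe_eq_one_iff (m : ℤ) (b : ℝ) :
    fourier m (b : AddCircle (1 : ℝ)) = 1 ↔ ∃ n : ℤ, m * b = n := by
  rw [fourier_coe_apply, Complex.exp_eq_one_iff]
  refine exists_congr fun n => ?_
  have h : (2 * (Real.pi : ℂ) * Complex.I) ≠ 0 := Complex.two_pi_I_ne_zero
  rw [show 2 * (Real.pi : ℂ) * Complex.I * m * b / (1 : ℝ)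
    = (m * b : ℂ) * (2 * Real.pi * Complex.I) by push_cast; ring, mul_left_inj' h]
  exact_mod_cast Iff.rfl

theorem norm_geom_average_le_one {z : ℂ} (hz : ‖z‖ = 1) (L : ℕ) :
    ‖(L : ℝ)⁻¹ • ∑ l ∈ Finset.range L, z ^ l‖ ≤ 1 := by
  rw [norm_smul, norm_inv, RCLike.norm_natCast]
  have : ‖∑ l ∈ Finset.range L, z ^ l‖ ≤ L := by
    refine (norm_sum_le _ _).trans ?_
    simp [hz]
  rcases Nat.eq_zero_or_pos L with rfl | hL
  · simp
  · have hL' : (0 : ℝ) < L := by exact_mod_cast hL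
    rw [inv_mul_le_iff₀ hL']
    simpa using this

theorem tendsto_geom_average {z : ℂ} (hz : ‖z‖ = 1) (h1 : z ≠ 1) :
    Tendsto (fun L : ℕ => ‖(L : ℝ)⁻¹ • ∑ l ∈ Finset.range L, z ^ l‖) atTop (𝓝 0) := by
  have hlim : Tendsto (fun L : ℕ => (L : ℝ)⁻¹ * (2 / ‖z - 1‖)) atTop (𝓝 0) := by
    simpa using (tendsto_inv_atTop_nhds_zero_nat (𝕜 := ℝ)).mul_const (2 / ‖z - 1‖)
  refine squeeze_zero (fun _ => norm_nonneg _) (fun L => ?_) hlim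
  rw [norm_smul, norm_inv, RCLike.norm_natCast, geom_sum_eq h1, norm_div]
  gcongr
  refine (norm_sub_le _ _).trans ?_
  rw [norm_pow, hz]
  norm_num

theorem eventually_card_angleWindow_lt {κ : ℝ} (hκ : 0 < κ) :
    ∀ᶠ ε in 𝓝[>] (0 : ℝ), (κ * ε) * (angleWindow κ ε).card < 2 * Real.pi + 1 := by
  have h1 : Tendsto (fun ε => (κ * ε) • ∑ k ∈ angleWindow κ ε, (1 : ℝ)) (𝓝[>] 0)
      (𝓝 (∫ α in (-Real.pi)..Real.pi, (1 : ℝ))) :=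
    tendsto_smul_sum_angleWindow hκ (C := 1) (Eventually.of_forall fun _ _ _ => by simp)
      (Eventually.of_forall fun _ _ => tendsto_const_nhds)
  have h2 : ∫ α in (-Real.pi)..Real.pi, (1 : ℝ) < 2 * Real.pi + 1 := by
    rw [integral_one]
    linarith
  exact (h1.eventually_lt_const h2).mono fun ε h => by simpa using h

section Equidistribution

variable {κ : ℝ} {g β : ℝ → ℝ} {u : ℝ → ℤ → ℝ}

theorem exists_abs_le_on_Icc (hg : ContinuousOn g (Set.Icc (-Real.pi) Real.pi)) :
    ∃ C : ℝ, 0 ≤ C ∧ ∀ α, |α| ≤ Real.pi → |g α| ≤ C := by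
  obtain ⟨C, hC⟩ := isCompact_Icc.exists_bound_of_continuousOn hg
  exact ⟨|C|, abs_nonneg _, fun α hα => (hC α (abs_le.1 hα)).trans (le_abs_self C)⟩

/-- The exponential sum with a nonzero frequency `m`, averaged over `L` consecutive indices, is
asymptotically at most the integral of `|g|` times the modulus of the mean of a geometric
progression: on a block of `L` consecutive indices, the phase is nearly linear. -/
theorem tendsto_integral_block_average (hκ : 0 < κ)
    (hg : ContinuousOn g (Set.Icc (-Real.pi) Real.pi))
    (hu : ∀ α (l : ℕ), Tendsto (fun ε => u ε (⌊α / (κ * ε)⌋ + l) - u ε ⌊α / (κ * ε)⌋)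
      (𝓝[>] 0) (𝓝 (l * β α))) (m : ℤ) (L : ℕ) :
    Tendsto (fun ε => ∫ α : ℝ, ‖(L : ℝ)⁻¹ • ∑ l ∈ Finset.range L,
        (fun k : ℤ => if k ∈ angleWindow κ ε then
          (g (angle κ ε k) : ℂ) * fourier m (u ε k : AddCircle (1 : ℝ)) else 0)
          (⌊α / (κ * ε)⌋ + l)‖) (𝓝[>] 0)
      (𝓝 (∫ α : ℝ, Set.indicator (Set.Ioo (-Real.pi) Real.pi)
        (fun α => |g α| * ‖(L : ℝ)⁻¹ • ∑ l ∈ Finset.range L,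
          (fourier m (β α : AddCircle (1 : ℝ))) ^ l‖) α)) := by
  obtain ⟨C, hC0, hC⟩ := exists_abs_le_on_Icc hg
  refine tendsto_integral_comp_floor_div hκ (C := C) (B := Real.pi + L)
    (G := fun ε k => ‖(L : ℝ)⁻¹ • ∑ l ∈ Finset.range L,
        (fun k : ℤ => if k ∈ angleWindow κ ε then
          (g (angle κ ε k) : ℂ) * fourier m (u ε k : AddCircle (1 : ℝ)) else 0) (k + l)‖)
    ?_ ?_ ?_
  · filter_upwards [eventually_mul_lt_one κ, self_mem_nhdsWithin] with ε hs hε k hk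
    have hp : 0 < κ * ε := mul_pos hκ hε
    rw [norm_ne_zero_iff] at hk
    obtain ⟨l, hl, hl'⟩ := Finset.exists_ne_zero_of_sum_ne_zero (right_ne_zero_of_smul hk)
    have hmem : k + l ∈ angleWindow κ ε := by
      by_contra h
      exact hl' (if_neg h)
    rw [mem_angleWindow hp, abs_le] at hmem
    have hlL : (l : ℝ) ≤ L := by exact_mod_cast (Finset.mem_range.1 hl).le
    have hl0 : (0 : ℝ) ≤ l := Nat.cast_nonneg l
    simp only [angle] at hmem ⊢
    push_cast at hmem
    rw [abs_le]
    constructor <;> nlinarith [mul_le_mul hlL hs.le hp.le (by positivity), mul_nonneg hl0 hp.le]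
  · filter_upwards [self_mem_nhdsWithin] with ε hε k
    have hb : ∀ k : ℤ, ‖(fun k : ℤ => if k ∈ angleWindow κ ε then
          (g (angle κ ε k) : ℂ) * fourier m (u ε k : AddCircle (1 : ℝ)) else 0) k‖ ≤ C := by
      intro k
      dsimp only
      split_ifs with h
      · rw [norm_mul, norm_fourier_coe, mul_one, Complex.norm_real]
        exact hC _ ((mem_angleWindow (mul_pos hκ hε) k).1 h)
      · simpa using hC0
    rw [norm_norm, norm_smul, norm_inv, RCLike.norm_natCast]
    have : ‖∑ l ∈ Finset.range L, (fun k : ℤ => if k ∈ angleWindow κ ε then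
          (g (angle κ ε k) : ℂ) * fourier m (u ε k : AddCircle (1 : ℝ)) else 0) (k + l)‖
        ≤ L * C := by
      refine (norm_sum_le_of_le (Finset.range L) fun l _ => hb (k + (l : ℤ))).trans ?_
      simp
    rcases Nat.eq_zero_or_pos L with rfl | hL
    · simpa using hC0
    · have hL' : (0 : ℝ) < L := by exact_mod_cast hL
      rwa [inv_mul_le_iff₀ hL']
  · have hne : ∀ᵐ α : ℝ, α ≠ Real.pi ∧ α ≠ -Real.pi := by
      refine Eventually.and ?_ ?_ <;> exact Measure.ae_ne volume _
    filter_upwards [hne] with α hα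
    by_cases hm : α ∈ Set.Ioo (-Real.pi) Real.pi
    · rw [Set.indicator_of_mem hm]
      have hga : ContinuousAt g α := hg.continuousAt (Icc_mem_nhds hm.1 hm.2)
      have hterm : ∀ l : ℕ, Tendsto (fun ε => (g (angle κ ε (⌊α / (κ * ε)⌋ + l)) : ℂ)
          * fourier m ((u ε (⌊α / (κ * ε)⌋ + l) - u ε ⌊α / (κ * ε)⌋ : ℝ) : AddCircle (1 : ℝ)))
          (𝓝[>] 0) (𝓝 ((g α : ℂ) * fourier m (β α : AddCircle (1 : ℝ)) ^ l)) := by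
        intro l
        rw [← fourier_coe_nat_mul]
        refine Tendsto.mul ?_ ?_
        · exact (Complex.continuous_ofReal.tendsto _).comp
            (hga.tendsto.comp (tendsto_mul_floor_div hκ α l))
        · exact ((fourier m).continuous.tendsto _).comp
            (((AddCircle.continuous_mk' (1 : ℝ)).tendsto _).comp (hu α l))
      have hsum := ((tendsto_finsetSum (Finset.range L) fun l _ => hterm l).const_smul
        ((L : ℝ)⁻¹)).norm
      have hval : |g α| * ‖(L : ℝ)⁻¹ • ∑ l ∈ Finset.range L,
          (fourier m (β α : AddCircle (1 : ℝ))) ^ l‖ = ‖(L : ℝ)⁻¹ • ∑ l ∈ Finset.range L,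
          (g α : ℂ) * (fourier m (β α : AddCircle (1 : ℝ))) ^ l‖ := by
        rw [← Finset.mul_sum, norm_smul, norm_smul, norm_mul, Complex.norm_real,
          Real.norm_eq_abs (g α)]
        ring
      rw [hval]
      refine hsum.congr' ?_
      have hwin : ∀ᶠ ε : ℝ in 𝓝[>] 0, ∀ l ∈ Finset.range L,
          ⌊α / (κ * ε)⌋ + (l : ℤ) ∈ angleWindow κ ε :=
        (Filter.eventually_all_finset _).2 fun l _ => eventually_mem_angleWindow hκ hm l
      filter_upwards [hwin] with ε hε
      -- the common unimodular factor of the block drops out of the norm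
      have hunit : ∀ w : ℂ,
          ‖w‖ = ‖fourier m (u ε ⌊α / (κ * ε)⌋ : AddCircle (1 : ℝ)) * w‖ := fun w => by
        rw [norm_mul, norm_fourier_coe, one_mul]
      refine (hunit _).trans ?_
      rw [mul_smul_comm, Finset.mul_sum]
      congr 2
      refine Finset.sum_congr rfl fun l hl => ?_
      rw [if_pos (hε l hl), mul_left_comm, ← fourier_coe_add, add_sub_cancel]
    · have hm' : α ∉ Set.Icc (-Real.pi) Real.pi := fun hc =>
        hm ⟨lt_of_le_of_ne hc.1 hα.2.symm, lt_of_le_of_ne hc.2 hα.1⟩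
      rw [Set.indicator_of_notMem hm]
      refine tendsto_const_nhds.congr' ?_
      have hwin : ∀ᶠ ε : ℝ in 𝓝[>] 0, ∀ l ∈ Finset.range L,
          ⌊α / (κ * ε)⌋ + (l : ℤ) ∉ angleWindow κ ε :=
        (Filter.eventually_all_finset _).2 fun l _ => eventually_notMem_angleWindow hκ hm' l
      filter_upwards [hwin] with ε hε
      rw [Finset.sum_eq_zero fun l hl => if_neg (hε l hl), smul_zero, norm_zero]

/-- Cancellation at a nonzero frequency: the block length `L` is chosen first, so large that the
mean of the geometric progression has small integral, and then the step size `ε`. -/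
theorem tendsto_sum_fourier_zero (hκ : 0 < κ)
    (hg : ContinuousOn g (Set.Icc (-Real.pi) Real.pi)) (hβ : Measurable β)
    (hu : ∀ α (l : ℕ), Tendsto (fun ε => u ε (⌊α / (κ * ε)⌋ + l) - u ε ⌊α / (κ * ε)⌋)
      (𝓝[>] 0) (𝓝 (l * β α))) {m : ℤ}
    (hm : ∀ᵐ α : ℝ, fourier m (β α : AddCircle (1 : ℝ)) ≠ 1) :
    Tendsto (fun ε => (κ * ε) • ∑ k ∈ angleWindow κ ε,
      (g (angle κ ε k) : ℂ) * fourier m (u ε k : AddCircle (1 : ℝ))) (𝓝[>] 0) (𝓝 0) := by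
  obtain ⟨C, hC0, hC⟩ := exists_abs_le_on_Icc hg
  have hL : Tendsto (fun L : ℕ => ∫ α : ℝ, Set.indicator (Set.Ioo (-Real.pi) Real.pi)
        (fun α => |g α| * ‖(L : ℝ)⁻¹ • ∑ l ∈ Finset.range L,
          (fourier m (β α : AddCircle (1 : ℝ))) ^ l‖) α) atTop (𝓝 0) := by
    rw [← integral_zero ℝ ℝ]
    have hb : Integrable (Set.indicator (Set.Ioo (-Real.pi) Real.pi) fun _ : ℝ => C) :=
      (integrable_indicator_iff measurableSet_Ioo).2 (integrableOn_const (by simp))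
    refine tendsto_integral_filter_of_dominated_convergence _ ?_ ?_ hb ?_
    · refine Eventually.of_forall fun L => ?_
      rw [aestronglyMeasurable_indicator_iff measurableSet_Ioo]
      refine AEStronglyMeasurable.mul ?_ ?_
      · exact ((hg.mono Set.Ioo_subset_Icc_self).abs).aestronglyMeasurable measurableSet_Ioo
      · have h1 : Measurable fun α => fourier m (β α : AddCircle (1 : ℝ)) :=
          ((fourier m).continuous.comp (AddCircle.continuous_mk' (1 : ℝ))).measurable.comp hβ
        have : Measurable fun α => ‖(L : ℝ)⁻¹ • ∑ l ∈ Finset.range L,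
            (fourier m (β α : AddCircle (1 : ℝ))) ^ l‖ := by fun_prop
        exact this.aestronglyMeasurable
    · refine Eventually.of_forall fun L => Eventually.of_forall fun α => ?_
      by_cases h : α ∈ Set.Ioo (-Real.pi) Real.pi
      · rw [Set.indicator_of_mem h, Set.indicator_of_mem h, norm_mul, norm_norm, Real.norm_eq_abs,
          abs_abs, ← mul_one C]
        exact mul_le_mul (hC _ (abs_le.2 ⟨h.1.le, h.2.le⟩))
          (norm_geom_average_le_one (norm_fourier_coe _ _) L) (norm_nonneg _) hC0
      · rw [Set.indicator_of_notMem h, Set.indicator_of_notMem h, norm_zero]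
    · filter_upwards [hm] with α hα
      by_cases h : α ∈ Set.Ioo (-Real.pi) Real.pi
      · simp only [Set.indicator_of_mem h]
        simpa using (tendsto_geom_average (norm_fourier_coe _ _) hα).const_mul |g α|
      · simp only [Set.indicator_of_notMem h]
        exact tendsto_const_nhds
  rw [Metric.tendsto_nhds]
  intro δ hδ
  obtain ⟨L, hLδ, hL0⟩ := ((hL.eventually_lt_const hδ).and (eventually_ne_atTop 0)).exists
  filter_upwards [(tendsto_integral_block_average hκ hg hu m L).eventually_lt_const hLδ,
    self_mem_nhdsWithin] with ε h1 hε
  have hp : 0 < κ * ε := mul_pos hκ hε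
  rw [dist_zero_right]
  refine lt_of_le_of_lt ?_ h1
  have hsupp : ∀ k ∉ angleWindow κ ε, (fun k : ℤ => if k ∈ angleWindow κ ε then
      (g (angle κ ε k) : ℂ) * fourier m (u ε k : AddCircle (1 : ℝ)) else 0) k = 0 :=
    fun k hk => if_neg hk
  refine le_trans (le_of_eq ?_) (norm_integral_comp_floor_div_le hp _ _ hsupp hL0)
  rw [integral_comp_floor_div hp _ _ hsupp]
  congr 2
  exact Finset.sum_congr rfl fun k hk => (if_pos hk).symm

/-- Equidistribution modulo one of `u ε k` as `ε → 0`, with weights `g (α_k)`, tested on continuous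
functions. If the increment of the phase from one index to the next is locally close to `β α`, it
suffices that no nonzero integer multiple of `β α` is an integer, for almost every `α`. -/
theorem tendsto_sum_comp_addCircle (hκ : 0 < κ)
    (hg : ContinuousOn g (Set.Icc (-Real.pi) Real.pi)) (hβ : Measurable β)
    (hu : ∀ α (l : ℕ), Tendsto (fun ε => u ε (⌊α / (κ * ε)⌋ + l) - u ε ⌊α / (κ * ε)⌋)
      (𝓝[>] 0) (𝓝 (l * β α)))
    (hm : ∀ m : ℤ, m ≠ 0 → ∀ᵐ α : ℝ, fourier m (β α : AddCircle (1 : ℝ)) ≠ 1)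
    (F : C(AddCircle (1 : ℝ), ℂ)) :
    Tendsto (fun ε => (κ * ε) • ∑ k ∈ angleWindow κ ε,
      (g (angle κ ε k) : ℂ) * F (u ε k : AddCircle (1 : ℝ))) (𝓝[>] 0)
      (𝓝 (((∫ α in (-Real.pi)..Real.pi, g α : ℝ) : ℂ)
        * ∫ θ, F θ ∂(AddCircle.haarAddCircle (T := (1 : ℝ))))) := by
  obtain ⟨C, hC0, hC⟩ := exists_abs_le_on_Icc hg
  set T : ℝ → C(AddCircle (1 : ℝ), ℂ) → ℂ := fun ε F => (κ * ε) • ∑ k ∈ angleWindow κ ε,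
      (g (angle κ ε k) : ℂ) * F (u ε k : AddCircle (1 : ℝ)) with hT
  set Λ : C(AddCircle (1 : ℝ), ℂ) → ℂ := fun F => ((∫ α in (-Real.pi)..Real.pi, g α : ℝ) : ℂ)
        * ∫ θ, F θ ∂(AddCircle.haarAddCircle (T := (1 : ℝ))) with hΛ
  have hFi : ∀ F : C(AddCircle (1 : ℝ), ℂ),
      Integrable F (AddCircle.haarAddCircle (T := (1 : ℝ))) := fun F =>
    F.continuous.integrable_of_hasCompactSupport (HasCompactSupport.of_compactSpace _)
  have hmass : Tendsto (fun ε => (κ * ε) • ∑ k ∈ angleWindow κ ε, g (angle κ ε k)) (𝓝[>] 0)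
      (𝓝 (∫ α in (-Real.pi)..Real.pi, g α)) := by
    refine tendsto_smul_sum_angleWindow hκ (C := C) ?_ ?_
    · filter_upwards [self_mem_nhdsWithin] with ε hε k hk
      exact hC _ ((mem_angleWindow (mul_pos hκ hε) k).1 hk)
    · refine Eventually.of_forall fun α hα => ?_
      have hga : ContinuousAt g α := hg.continuousAt (Icc_mem_nhds hα.1 hα.2)
      simpa [Function.comp_def] using hga.tendsto.comp (tendsto_mul_floor_div hκ α 0)
  have hcard := eventually_card_angleWindow_lt hκ
  have hTadd : ∀ ε F G, T ε (F + G) = T ε F + T ε G := by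
    intro ε F G
    simp only [hT, ContinuousMap.add_apply, mul_add, Finset.sum_add_distrib, smul_add]
  have hTsmul : ∀ ε (c : ℂ) F, T ε (c • F) = c * T ε F := by
    intro ε c F
    simp only [hT, ContinuousMap.smul_apply, smul_eq_mul, Complex.real_smul, Finset.mul_sum]
    exact Finset.sum_congr rfl fun k _ => by ring
  have hΛadd : ∀ F G, Λ (F + G) = Λ F + Λ G := by
    intro F G
    simp only [hΛ, ContinuousMap.add_apply]
    rw [integral_add (hFi F) (hFi G), mul_add]
  have hΛsmul : ∀ (c : ℂ) F, Λ (c • F) = c * Λ F := by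
    intro c F
    simp only [hΛ, ContinuousMap.smul_apply, smul_eq_mul, integral_const_mul]
    ring
  have hspan : ∀ F ∈ Submodule.span ℂ (Set.range (fourier (T := (1 : ℝ)))),
      Tendsto (fun ε => T ε F) (𝓝[>] 0) (𝓝 (Λ F)) := by
    intro F hF
    induction hF using Submodule.span_induction with
    | mem F hF =>
      obtain ⟨m, rfl⟩ := hF
      by_cases h0 : m = 0
      · subst h0
        have : Λ (fourier 0) = ((∫ α in (-Real.pi)..Real.pi, g α : ℝ) : ℂ) := by
          simp [hΛ]
        rw [this]
        refine ((Complex.continuous_ofReal.tendsto _).comp hmass).congr fun ε => ?_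
        simp [hT]
      · have hz : ∫ θ, fourier m θ ∂(AddCircle.haarAddCircle (T := (1 : ℝ))) = 0 := by
          have := integral_eq_zero_of_add_right_eq_neg (μ := AddCircle.haarAddCircle (T := (1 : ℝ)))
            (fourier_add_half_inv_index h0 (by norm_num))
          simpa using this
        have : Λ (fourier m) = 0 := by simp only [hΛ, hz, mul_zero]
        rw [this]
        exact tendsto_sum_fourier_zero hκ hg hβ hu (hm m h0)
    | zero => simp [hT, hΛ]
    | add F G _ _ hF hG => simpa only [hTadd, hΛadd] using hF.add hG
    | smul c F _ hF => simpa only [hTsmul, hΛsmul] using hF.const_mul c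
  -- both functionals are bounded, uniformly in `ε`, so trigonometric polynomials suffice
  have hTle : ∀ᶠ ε in 𝓝[>] (0 : ℝ), ∀ F, ‖T ε F‖ ≤ (2 * Real.pi + 1) * C * ‖F‖ := by
    filter_upwards [hcard, self_mem_nhdsWithin] with ε h hε F
    have hp : 0 < κ * ε := mul_pos hκ hε
    simp only [hT]
    rw [norm_smul, Real.norm_of_nonneg hp.le]
    have : ‖∑ k ∈ angleWindow κ ε, (g (angle κ ε k) : ℂ) * F (u ε k : AddCircle (1 : ℝ))‖
        ≤ (angleWindow κ ε).card * (C * ‖F‖) := by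
      refine (norm_sum_le_of_le _ (f := fun k => (g (angle κ ε k) : ℂ) * F (u ε k))
        (n := fun _ => C * ‖F‖) fun k hk => ?_).trans (by simp)
      rw [norm_mul, Complex.norm_real]
      exact mul_le_mul (hC _ ((mem_angleWindow hp k).1 hk)) (F.norm_coe_le_norm _)
        (norm_nonneg _) hC0
    calc κ * ε * ‖_‖ ≤ κ * ε * ((angleWindow κ ε).card * (C * ‖F‖)) := by gcongr
      _ = (κ * ε * (angleWindow κ ε).card) * (C * ‖F‖) := by ring
      _ ≤ (2 * Real.pi + 1) * (C * ‖F‖) := by gcongr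
      _ = _ := by ring
  set D : ℝ := |∫ α in (-Real.pi)..Real.pi, g α| with hD
  have hΛle : ∀ F, ‖Λ F‖ ≤ D * ‖F‖ := by
    intro F
    simp only [hΛ]
    rw [norm_mul, Complex.norm_real, Real.norm_eq_abs]
    refine mul_le_mul_of_nonneg_left ?_ (abs_nonneg _)
    have := norm_integral_le_of_norm_le_const (μ := AddCircle.haarAddCircle (T := (1 : ℝ)))
      (f := F) (C := ‖F‖) (Eventually.of_forall fun θ => F.norm_coe_le_norm θ)
    simpa using this
  change Tendsto (fun ε => T ε F) (𝓝[>] 0) (𝓝 (Λ F))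
  rw [Metric.tendsto_nhds]
  intro δ hδ
  set A : ℝ := (2 * Real.pi + 1) * C with hA
  have hA0 : 0 ≤ A := by positivity
  have hD0 : 0 ≤ D := abs_nonneg _
  have hmem : F ∈ (Submodule.span ℂ (Set.range (fourier (T := (1 : ℝ))))).topologicalClosure := by
    rw [span_fourier_closure_eq_top]; trivial
  obtain ⟨G, hG, hFG⟩ := Metric.mem_closure_iff.1 hmem (δ / (2 * (A + D + 1))) (by positivity)
  have hFG' : ‖F - G‖ < δ / (2 * (A + D + 1)) := by rwa [← dist_eq_norm]
  filter_upwards [hTle, Metric.tendsto_nhds.1 (hspan G hG) (δ / 2) (by positivity)] with ε h1 h2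
  have e1 : T ε F = T ε (F - G) + T ε G := by rw [← hTadd, sub_add_cancel]
  have e2 : Λ F = Λ (F - G) + Λ G := by rw [← hΛadd, sub_add_cancel]
  rw [dist_eq_norm] at h2 ⊢
  have e3 : T ε F - Λ F = T ε (F - G) - Λ (F - G) + (T ε G - Λ G) := by rw [e1, e2]; ring
  have h3 : ‖T ε F - Λ F‖ ≤ A * ‖F - G‖ + D * ‖F - G‖ + ‖T ε G - Λ G‖ := by
    rw [e3]
    refine (norm_add_le _ _).trans ?_
    have := norm_sub_le (T ε (F - G)) (Λ (F - G))
    linarith [h1 (F - G), hΛle (F - G)]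
  have h4 : (A + D + 1) * ‖F - G‖ ≤ δ / 2 := by
    rw [lt_div_iff₀ (by positivity)] at hFG'
    linarith
  nlinarith [norm_nonneg (F - G)]

end Equidistribution

/-! ### The phase -/

theorem inner_unitVec (α : ℝ) (y : EuclideanSpace ℝ (Fin 2)) :
    inner ℝ (unitVec α) y = Real.cos α * y 0 + Real.sin α * y 1 := by
  simp [unitVec, PiLp.inner_apply, Fin.sum_univ_two, mul_comm]

theorem norm_unitVec (α : ℝ) : ‖unitVec α‖ = 1 := by
  simp [unitVec, EuclideanSpace.norm_eq, Fin.sum_univ_two]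

theorem abs_inner_unitVec_le (α : ℝ) (y : EuclideanSpace ℝ (Fin 2)) :
    |inner ℝ (unitVec α) y| ≤ ‖y‖ := by
  simpa [norm_unitVec] using abs_real_inner_le_norm (unitVec α) y

theorem continuous_inner_unitVec (y : EuclideanSpace ℝ (Fin 2)) :
    Continuous fun α => inner ℝ (unitVec α) y := by
  simp_rw [inner_unitVec]
  fun_prop

theorem hasStrictDerivAt_inner_unitVec (α : ℝ) (y : EuclideanSpace ℝ (Fin 2)) :
    HasStrictDerivAt (fun α => inner ℝ (unitVec α) y)
      (inner ℝ (unitVec (α + Real.pi / 2)) y) α := by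
  simp_rw [inner_unitVec, Real.cos_add_pi_div_two, Real.sin_add_pi_div_two]
  exact ((Real.hasStrictDerivAt_cos α).mul_const _).add ((Real.hasStrictDerivAt_sin α).mul_const _)

theorem exists_inner_unitVec_eq_cos (y : EuclideanSpace ℝ (Fin 2)) :
    ∃ θ : ℝ, ∀ α, inner ℝ (unitVec α) y = ‖y‖ * Real.cos (α - θ) := by
  refine ⟨Complex.arg ⟨y 0, y 1⟩, fun α => ?_⟩
  have hn : ‖y‖ = ‖(⟨y 0, y 1⟩ : ℂ)‖ := by
    rw [EuclideanSpace.norm_eq, Complex.norm_eq_sqrt_sq_add_sq]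
    simp [Fin.sum_univ_two]
  rw [inner_unitVec, Real.cos_sub, hn, mul_add, mul_left_comm, Complex.norm_mul_cos_arg,
    mul_left_comm, Complex.norm_mul_sin_arg]

/-- A nonzero sinusoid takes each value only countably often. -/
theorem ae_inner_unitVec_ne {y : EuclideanSpace ℝ (Fin 2)} (hy : y ≠ 0) (c : ℝ) :
    ∀ᵐ α : ℝ, inner ℝ (unitVec α) y ≠ c := by
  obtain ⟨θ, hθ⟩ := exists_inner_unitVec_eq_cos y
  have hn : ‖y‖ ≠ 0 := norm_ne_zero_iff.2 hy
  have hcount : {α : ℝ | inner ℝ (unitVec α) y = c}.Countable := by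
    by_cases hex : ∃ α₀, inner ℝ (unitVec α₀) y = c
    · obtain ⟨α₀, h₀⟩ := hex
      have : {α : ℝ | inner ℝ (unitVec α) y = c} ⊆
          (Set.range fun k : ℤ => θ + (2 * k * Real.pi + (α₀ - θ)))
            ∪ Set.range fun k : ℤ => θ + (2 * k * Real.pi - (α₀ - θ)) := by
        intro α hα
        have hα' : inner ℝ (unitVec α) y = c := hα
        rw [← h₀, hθ, hθ] at hα'
        obtain ⟨k, hk | hk⟩ := Real.cos_eq_cos_iff.1 (mul_left_cancel₀ hn hα').symm
        · exact Or.inl ⟨k, by simp only; linarith⟩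
        · exact Or.inr ⟨k, by simp only; linarith⟩
      exact ((Set.countable_range _).union (Set.countable_range _)).mono this
    · push Not at hex
      convert Set.countable_empty
      ext α
      simp [hex α]
  have := hcount.ae_notMem volume
  exact this

/-- The radial coordinate, in units of the step and relative to the grid, of the line through
`x₀ + ε x` with the grid direction of index `k`. -/
noncomputable def phase (κ pbar : ℝ) (x₀ x : EuclideanSpace ℝ (Fin 2)) (ε : ℝ) (k : ℤ) : ℝ :=
  (inner ℝ (unitVec (angle κ ε k)) x₀ - pbar) / ε + inner ℝ (unitVec (angle κ ε k)) x

theorem tendsto_phase_increment {κ : ℝ} (hκ : 0 < κ) (pbar : ℝ)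
    (x₀ x : EuclideanSpace ℝ (Fin 2)) (α : ℝ) (l : ℕ) :
    Tendsto (fun ε => phase κ pbar x₀ x ε (⌊α / (κ * ε)⌋ + l) - phase κ pbar x₀ x ε ⌊α / (κ * ε)⌋)
      (𝓝[>] 0) (𝓝 (l * (κ * inner ℝ (unitVec (α + Real.pi / 2)) x₀))) := by
  have hl := tendsto_mul_floor_div hκ α l
  have h0 := tendsto_mul_floor_div hκ α 0
  simp only [add_zero] at h0
  have hx : Tendsto (fun ε => inner ℝ (unitVec (angle κ ε (⌊α / (κ * ε)⌋ + l))) x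
      - inner ℝ (unitVec (angle κ ε ⌊α / (κ * ε)⌋)) x) (𝓝[>] 0) (𝓝 0) := by
    have hc := (continuous_inner_unitVec x).tendsto α
    simpa using (hc.comp hl).sub (hc.comp h0)
  have hlo := ((hasStrictDerivAt_inner_unitVec α x₀).isLittleO.comp_tendsto (hl.prodMk_nhds h0))
  have hO : (fun ε : ℝ => angle κ ε (⌊α / (κ * ε)⌋ + l) - angle κ ε ⌊α / (κ * ε)⌋)
      =O[𝓝[>] 0] fun ε : ℝ => ε := by
    have : (fun ε : ℝ => angle κ ε (⌊α / (κ * ε)⌋ + l) - angle κ ε ⌊α / (κ * ε)⌋)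
        = fun ε => (l * κ) * ε := by
      ext ε
      simp only [angle]
      push_cast
      ring
    rw [this]
    exact Asymptotics.isBigO_const_mul_self _ _ _
  have hdiv := (hlo.trans_isBigO hO).tendsto_div_nhds_zero
  have := (hdiv.add hx).const_add (l * (κ * inner ℝ (unitVec (α + Real.pi / 2)) x₀))
  rw [add_zero, add_zero] at this
  refine this.congr' ?_
  filter_upwards [self_mem_nhdsWithin] with ε hε
  have hε' : ε ≠ 0 := ne_of_gt hε
  simp only [Function.comp_apply, phase, angle, ContinuousLinearMap.toSpanSingleton_apply,
    smul_eq_mul]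
  push_cast
  field_simp
  ring

/-! ### Sums over shifts of a decaying function -/

theorem summable_three_mul_div_one_add_sq (K : ℝ) :
    Summable fun i : ℤ => 3 * K / (1 + (i : ℝ) ^ 2) := by
  have h : Summable fun i : ℤ => 1 / (i : ℝ) ^ 2 := Real.summable_one_div_int_pow.2 one_lt_two
  have h' : Summable fun i : ℤ => (1 : ℝ) / (1 + (i : ℝ) ^ 2) := by
    refine Summable.of_norm_bounded_eventually h ?_
    filter_upwards [(Set.finite_singleton (0 : ℤ)).compl_mem_cofinite] with i hi
    have hi' : (i : ℝ) ≠ 0 := by exact_mod_cast hi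
    rw [Real.norm_of_nonneg (by positivity)]
    exact one_div_le_one_div_of_le (by positivity) (by linarith)
  exact (h'.mul_left (3 * K)).congr fun i => mul_one_div _ _

theorem nonneg_of_forall_abs_le_div {w : ℝ → ℝ} {K : ℝ} (hw : ∀ t, |w t| ≤ K / (1 + t ^ 2)) :
    0 ≤ K := by
  have := (abs_nonneg _).trans (hw 0)
  simpa using this

/-- Shifting by a fractional part costs at most a factor `3`. -/
theorem abs_comp_fract_sub_le {w : ℝ → ℝ} {K : ℝ} (hw : ∀ t, |w t| ≤ K / (1 + t ^ 2)) (u : ℝ)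
    (i : ℤ) : |w (Int.fract u - i)| ≤ 3 * K / (1 + (i : ℝ) ^ 2) := by
  have hK : 0 ≤ K := nonneg_of_forall_abs_le_div hw
  refine (hw _).trans ?_
  rw [div_le_div_iff₀ (by positivity) (by positivity), mul_comm 3 K, mul_assoc]
  refine mul_le_mul_of_nonneg_left ?_ hK
  have h0 := Int.fract_nonneg u
  have h1 := (Int.fract_lt_one u).le
  nlinarith [sq_nonneg ((i : ℝ) - 2 * Int.fract u), sq_nonneg (2 * (i : ℝ) - 3 * Int.fract u)]

theorem sum_abs_comp_sub_le {w : ℝ → ℝ} {K : ℝ} (hw : ∀ t, |w t| ≤ K / (1 + t ^ 2)) (u : ℝ)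
    (J : Finset ℤ) :
    ∑ j ∈ J, |w (u - j)| ≤ ∑' i : ℤ, 3 * K / (1 + (i : ℝ) ^ 2) := by
  have hK : 0 ≤ K := nonneg_of_forall_abs_le_div hw
  have hs := summable_three_mul_div_one_add_sq K
  rw [← (Equiv.subRight ⌊u⌋).tsum_eq fun i : ℤ => 3 * K / (1 + (i : ℝ) ^ 2)]
  refine le_trans (Finset.sum_le_sum fun j _ => ?_)
    (((Equiv.subRight ⌊u⌋).summable_iff.2 hs).sum_le_tsum J fun i _ => by positivity)
  have := abs_comp_fract_sub_le hw u (j - ⌊u⌋)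
  simp only [Equiv.subRight_apply]
  refine le_trans (le_of_eq ?_) this
  congr 2
  push_cast
  rw [Int.fract]
  ring

/-- The periodization of a continuous function with decay `1 / (1 + t²)`, as a continuous function
on the circle: its mean is the integral of the function. -/
theorem exists_periodization {w : ℝ → ℝ} {K : ℝ} (hc : Continuous w)
    (hw : ∀ t, |w t| ≤ K / (1 + t ^ 2)) :
    ∃ F : C(AddCircle (1 : ℝ), ℂ),
      (∀ u : ℝ, F (u : AddCircle (1 : ℝ)) = ((∑' i : ℤ, w (Int.fract u - i) : ℝ) : ℂ)) ∧
      ∫ θ, F θ ∂(AddCircle.haarAddCircle (T := (1 : ℝ))) = ((∫ r, w r : ℝ) : ℂ) := by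
  set f : C(ℝ, ℂ) := ⟨fun t => (w t : ℂ), Complex.continuous_ofReal.comp hc⟩ with hf
  have hK : 0 ≤ K := nonneg_of_forall_abs_le_div hw
  have hO : (⇑f) =O[cocompact ℝ] fun t : ℝ => |t| ^ (-2 : ℝ) := by
    refine Asymptotics.IsBigO.of_bound K ?_
    filter_upwards [tendsto_norm_cocompact_atTop.eventually_gt_atTop (0 : ℝ)] with t ht
    have ht' : 0 < |t| := ht
    have hp : 0 < t ^ 2 := by rw [← sq_abs]; positivity
    have e1 : ‖f t‖ = |w t| := by simp [hf]
    have e2 : |t| ^ (-2 : ℝ) = (t ^ 2)⁻¹ := by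
      rw [Real.rpow_neg ht'.le, Real.rpow_two, sq_abs]
    rw [e1, e2, Real.norm_of_nonneg (by positivity), ← div_eq_mul_inv]
    exact (hw t).trans (div_le_div_of_nonneg_left hK hp (by linarith))
  have hsum : ∀ S : TopologicalSpace.Compacts ℝ,
      Summable fun n : ℤ => ‖(f.comp (ContinuousMap.addRight (n : ℝ))).restrict S‖ := fun S =>
    summable_of_isBigO (Real.summable_abs_int_rpow one_lt_two)
      ((isBigO_norm_restrict_cocompact f zero_lt_two hO S).comp_tendsto
        Int.tendsto_coe_cofinite)
  refine ⟨⟨(f.periodic_tsum_comp_add_zsmul 1).lift, continuous_coinduced_dom.mpr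
    (map_continuous _)⟩, fun u => ?_, ?_⟩
  · have hs : Summable fun n : ℤ => f.comp (ContinuousMap.addRight (n • (1 : ℝ))) :=
      ContinuousMap.summable_of_locally_summable_norm (by simpa using hsum)
    simp only [ContinuousMap.coe_mk, Function.Periodic.lift_coe]
    rw [← ContinuousMap.tsum_apply hs, Complex.ofReal_tsum,
      ← ((Equiv.subLeft (-⌊u⌋)).tsum_eq _)]
    refine tsum_congr fun i => ?_
    simp only [hf, ContinuousMap.comp_apply, ContinuousMap.coe_mk, ContinuousMap.coe_addRight,
      Equiv.subLeft_apply, Int.fract]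
    rw [zsmul_one]
    congr 2
    push_cast
    ring
  · have h2 : ∫ x, f x = ((∫ r, w r : ℝ) : ℂ) := integral_complex_ofReal
    rw [← h2]
    have := Real.fourierCoeff_tsum_comp_add (f := f) hsum 0
    simpa [fourierCoeff, Real.fourier_eq] using this

/-! ### Sums over the grid -/

/-- The indices `j` with `|p_j| ≤ P`. -/
noncomputable def offsetWindow (pbar P ε : ℝ) : Finset ℤ :=
  Finset.Icc ⌈(-P - pbar) / ε⌉ ⌊(P - pbar) / ε⌋

theorem mem_offsetWindow {pbar P ε : ℝ} (hε : 0 < ε) (j : ℤ) :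
    j ∈ offsetWindow pbar P ε ↔ |offset pbar ε j| ≤ P := by
  simp only [offsetWindow, offset, Finset.mem_Icc, Int.ceil_le, Int.le_floor, abs_le,
    div_le_iff₀ hε, le_div_iff₀ hε]
  constructor <;> rintro ⟨h1, h2⟩ <;> constructor <;> linarith

theorem sum_grid {E : Type*} [AddCommMonoid E] (κ pbar P ε : ℝ) (f : ℤ × ℤ → E) :
    ∑ i ∈ grid κ pbar P ε, f i
      = ∑ k ∈ angleWindow κ ε, ∑ j ∈ offsetWindow pbar P ε, f (k, j) :=
  Finset.sum_product _ _ _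

/-- Counting the offsets from `⌊u⌋` gives the summands a bound that does not depend on `u`, as
dominated convergence requires. -/
theorem sum_mul_eq_tsum_fract (w : ℝ → ℝ) (v : ℤ → ℝ) (u : ℝ) (J : Finset ℤ) :
    ∑ j ∈ J, w (u - j) * v j
      = ∑' i : ℤ, w (Int.fract u - i) * (if ⌊u⌋ + i ∈ J then v (⌊u⌋ + i) else 0) := by
  have h : ∑ j ∈ J, w (u - j) * v j = ∑' j : ℤ, w (u - j) * (if j ∈ J then v j else 0) := by
    rw [tsum_eq_sum (s := J) fun j hj => by rw [if_neg hj, mul_zero]]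
    exact Finset.sum_congr rfl fun j hj => by rw [if_pos hj]
  rw [h, ← (Equiv.addLeft ⌊u⌋).tsum_eq]
  refine tsum_congr fun i => ?_
  simp only [Equiv.coe_addLeft, Int.fract]
  congr 2
  push_cast
  ring

/-- Even if `‖y‖ = P`, the lines through `y` stay away from the edge of the observation space,
except for a null set of directions. -/
theorem abs_inner_unitVec_lt_ae {y : EuclideanSpace ℝ (Fin 2)} (hy : y ≠ 0) {P : ℝ}
    (hP : ‖y‖ ≤ P) : ∀ᵐ α : ℝ, |inner ℝ (unitVec α) y| < P := by
  filter_upwards [ae_inner_unitVec_ne hy P, ae_inner_unitVec_ne hy (-P)] with α h1 h2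
  refine lt_of_le_of_ne ((abs_inner_unitVec_le α y).trans hP) fun h => ?_
  rcases eq_or_eq_neg_of_abs_eq h with h | h
  · exact h1 h
  · exact h2 h

/-- Only the grid points near the line through `x₀` contribute in the limit, so the second argument
of the density `V` may be replaced by the radial coordinate of that line, and the sum over `j` may
be completed to a sum over all integers. -/
theorem tendsto_grid_sum_sub {κ pbar P : ℝ} (hκ : 0 < κ) {x₀ : EuclideanSpace ℝ (Fin 2)}
    (hx₀ : x₀ ≠ 0) (hP : ‖x₀‖ ≤ P) (x : EuclideanSpace ℝ (Fin 2)) {w : ℝ → ℝ} {K : ℝ}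
    (hw : ∀ t, |w t| ≤ K / (1 + t ^ 2)) {V : ℝ → ℝ → ℝ}
    (hV : ContinuousOn (Function.uncurry V)
      (Set.Icc (-Real.pi) Real.pi ×ˢ Set.Icc (-P) P)) :
    Tendsto (fun ε => (κ * ε) • ∑ k ∈ angleWindow κ ε,
      (∑ j ∈ offsetWindow pbar P ε, w (phase κ pbar x₀ x ε k - j)
          * V (angle κ ε k) (offset pbar ε j)
        - V (angle κ ε k) (inner ℝ (unitVec (angle κ ε k)) x₀)
          * ∑' i : ℤ, w (Int.fract (phase κ pbar x₀ x ε k) - i))) (𝓝[>] 0) (𝓝 0) := by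
  obtain ⟨C, hC⟩ := (isCompact_Icc.prod isCompact_Icc).exists_bound_of_continuousOn hV
  have hK : 0 ≤ K := nonneg_of_forall_abs_le_div hw
  have hC' : ∀ α p, |α| ≤ Real.pi → |p| ≤ P → |V α p| ≤ C := fun α p h1 h2 =>
    hC (α, p) ⟨abs_le.1 h1, abs_le.1 h2⟩
  have hC0 : 0 ≤ C := (abs_nonneg _).trans
    (hC' 0 0 (by simpa using Real.pi_pos.le) (by simpa using (norm_nonneg x₀).trans hP))
  set b : ℤ → ℝ := fun i => 3 * K / (1 + (i : ℝ) ^ 2) with hb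
  have hbs : Summable b := summable_three_mul_div_one_add_sq K
  set A : ℝ → ℝ := fun α => inner ℝ (unitVec α) x₀ with hA
  have hAc : Continuous A := continuous_inner_unitVec x₀
  set u := phase κ pbar x₀ x with hu
  set D : ℝ → ℤ → ℤ → ℝ := fun ε k i =>
    (if ⌊u ε k⌋ + i ∈ offsetWindow pbar P ε then
      V (angle κ ε k) (offset pbar ε (⌊u ε k⌋ + i)) else 0) - V (angle κ ε k) (A (angle κ ε k))
    with hD
  have hDle : ∀ ε : ℝ, 0 < ε → ∀ k ∈ angleWindow κ ε, ∀ i : ℤ, |D ε k i| ≤ 2 * C := by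
    intro ε hε k hk i
    have hk' := (mem_angleWindow (mul_pos hκ hε) k).1 hk
    have h1 := hC' _ _ hk' ((abs_inner_unitVec_le (angle κ ε k) x₀).trans hP)
    refine (abs_sub _ _).trans ?_
    have h2 : |if ⌊u ε k⌋ + i ∈ offsetWindow pbar P ε then
        V (angle κ ε k) (offset pbar ε (⌊u ε k⌋ + i)) else 0| ≤ C := by
      split_ifs with h
      · exact hC' _ _ hk' ((mem_offsetWindow hε _).1 h)
      · simpa using hC0
    linarith
  have hterm : ∀ ε : ℝ, 0 < ε → ∀ k ∈ angleWindow κ ε, ∀ i : ℤ,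
      ‖w (Int.fract (u ε k) - i) * D ε k i‖ ≤ b i * (2 * C) := by
    intro ε hε k hk i
    rw [norm_mul]
    exact mul_le_mul (abs_comp_fract_sub_le hw _ i) (hDle ε hε k hk i) (norm_nonneg _)
      (by positivity)
  have hbC : Summable fun i => b i * (2 * C) := hbs.mul_right _
  have hrew : ∀ ε : ℝ, ∀ k,
      ∑ j ∈ offsetWindow pbar P ε, w (u ε k - j) * V (angle κ ε k) (offset pbar ε j)
        - V (angle κ ε k) (A (angle κ ε k)) * ∑' i : ℤ, w (Int.fract (u ε k) - i)
      = ∑' i : ℤ, w (Int.fract (u ε k) - i) * D ε k i := by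
    intro ε k
    have hws : Summable fun i : ℤ => w (Int.fract (u ε k) - i) :=
      Summable.of_norm_bounded hbs fun i => abs_comp_fract_sub_le hw _ i
    have hfs : Summable fun i : ℤ => w (Int.fract (u ε k) - i)
        * (if ⌊u ε k⌋ + i ∈ offsetWindow pbar P ε then
          V (angle κ ε k) (offset pbar ε (⌊u ε k⌋ + i)) else 0) := by
      refine summable_of_ne_finset_zero
        (s := (offsetWindow pbar P ε).image fun j => j - ⌊u ε k⌋) fun i hi => ?_
      rw [if_neg, mul_zero]
      intro hmem
      exact hi (Finset.mem_image.2 ⟨_, hmem, by ring⟩)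
    rw [sum_mul_eq_tsum_fract w (fun j => V (angle κ ε k) (offset pbar ε j)), ← tsum_mul_left,
      ← hfs.tsum_sub (hws.mul_left _)]
    exact tsum_congr fun i => by simp only [hD]; ring
  have key := tendsto_smul_sum_angleWindow (E := ℝ) hκ (f := fun _ => 0)
    (F := fun ε k => ∑' i : ℤ, w (Int.fract (u ε k) - i) * D ε k i)
    (C := ∑' i, b i * (2 * C)) ?_ ?_
  · simp only [intervalIntegral.integral_zero] at key
    exact key.congr fun ε =>
      congrArg _ (Finset.sum_congr rfl fun k _ => (hrew ε k).symm)
  · filter_upwards [self_mem_nhdsWithin] with ε hε k hk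
    exact tsum_of_norm_bounded hbC.hasSum (hterm ε hε k hk)
  · filter_upwards [abs_inner_unitVec_lt_ae hx₀ hP] with α hαP hα
    have hwin := eventually_mem_angleWindow hκ hα 0
    simp only [add_zero] at hwin
    have hang := tendsto_mul_floor_div hκ α 0
    simp only [add_zero] at hang
    suffices h : Tendsto (fun ε => ∑' i : ℤ, w (Int.fract (u ε ⌊α / (κ * ε)⌋) - i)
        * D ε ⌊α / (κ * ε)⌋ i) (𝓝[>] 0) (𝓝 (∑' _ : ℤ, (0 : ℝ))) by
      simpa only [tsum_zero] using h
    refine tendsto_tsum_of_dominated_convergence hbC (fun i => ?_) ?_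
    · have hVc : ContinuousAt (Function.uncurry V) (α, A α) :=
        hV.continuousAt (prod_mem_nhds (Icc_mem_nhds hα.1 hα.2)
          (Icc_mem_nhds (abs_lt.1 hαP).1 (abs_lt.1 hαP).2))
      have hAlim : Tendsto (fun ε => A (angle κ ε ⌊α / (κ * ε)⌋)) (𝓝[>] 0) (𝓝 (A α)) :=
        (hAc.tendsto α).comp hang
      -- the offset with index `⌊u⌋ + i` differs from the radial coordinate of the line by `O(ε)`
      have hoff : Tendsto (fun ε => offset pbar ε (⌊u ε ⌊α / (κ * ε)⌋⌋ + i)) (𝓝[>] 0)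
          (𝓝 (A α)) := by
        have hz : Tendsto (fun ε : ℝ => ε * (inner ℝ (unitVec (angle κ ε ⌊α / (κ * ε)⌋)) x
            - Int.fract (u ε ⌊α / (κ * ε)⌋) + i)) (𝓝[>] 0) (𝓝 0) := by
          refine Tendsto.zero_mul_isBoundedUnder_le
            (tendsto_nhdsWithin_of_tendsto_nhds tendsto_id) ?_
          refine isBoundedUnder_of ⟨‖x‖ + 1 + |(i : ℝ)|, fun ε => ?_⟩
          simp only [Function.comp_apply, Real.norm_eq_abs]
          have h1 := abs_inner_unitVec_le (angle κ ε ⌊α / (κ * ε)⌋) x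
          have h2 : |Int.fract (u ε ⌊α / (κ * ε)⌋)| ≤ 1 := by
            rw [abs_of_nonneg (Int.fract_nonneg _)]
            exact (Int.fract_lt_one _).le
          refine (abs_add_le _ _).trans ?_
          have := abs_sub (inner ℝ (unitVec (angle κ ε ⌊α / (κ * ε)⌋)) x)
            (Int.fract (u ε ⌊α / (κ * ε)⌋))
          linarith
        have := hAlim.add hz
        rw [add_zero] at this
        refine this.congr' ?_
        filter_upwards [self_mem_nhdsWithin] with ε hε
        have hε' : ε ≠ 0 := ne_of_gt hε
        rw [Int.fract]
        simp only [offset, hu, phase, hA]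
        push_cast
        field_simp
        ring
      have hmem : ∀ᶠ ε in 𝓝[>] (0 : ℝ),
          ⌊u ε ⌊α / (κ * ε)⌋⌋ + i ∈ offsetWindow pbar P ε := by
        filter_upwards [hoff.abs.eventually_lt_const hαP, self_mem_nhdsWithin] with ε h hε
        exact (mem_offsetWindow hε _).2 h.le
      have hDlim : Tendsto (fun ε => D ε ⌊α / (κ * ε)⌋ i) (𝓝[>] 0) (𝓝 0) := by
        have h1 := hVc.tendsto.comp (hang.prodMk_nhds hoff)
        have h2 := hVc.tendsto.comp (hang.prodMk_nhds hAlim)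
        have h3 := h1.sub h2
        rw [sub_self] at h3
        refine h3.congr' ?_
        filter_upwards [hmem] with ε h
        simp only [hD, if_pos h, Function.comp_apply, Function.uncurry_apply_pair]
      refine squeeze_zero_norm (a := fun ε => b i * ‖D ε ⌊α / (κ * ε)⌋ i‖) (fun ε => ?_) ?_
      · rw [norm_mul]
        exact mul_le_mul_of_nonneg_right (abs_comp_fract_sub_le hw _ i) (norm_nonneg _)
      · simpa using hDlim.norm.const_mul (b i)
    · filter_upwards [hwin, self_mem_nhdsWithin] with ε h hε i
      exact hterm ε hε _ h i

/-- The limit of the weighted sums over the grid, for a kernel `w` with decay `1 / (1 + t²)` and a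
density `V` which is continuous on the observation space. -/
theorem tendsto_grid_sum {κ pbar P : ℝ} (hκ : 0 < κ) {x₀ : EuclideanSpace ℝ (Fin 2)}
    (hx₀ : x₀ ≠ 0) (hP : ‖x₀‖ ≤ P) (x : EuclideanSpace ℝ (Fin 2)) {w : ℝ → ℝ} {K : ℝ}
    (hwc : Continuous w) (hw : ∀ t, |w t| ≤ K / (1 + t ^ 2)) {V : ℝ → ℝ → ℝ}
    (hV : ContinuousOn (Function.uncurry V)
      (Set.Icc (-Real.pi) Real.pi ×ˢ Set.Icc (-P) P)) :
    Tendsto (fun ε => (κ * ε) • ∑ k ∈ angleWindow κ ε, ∑ j ∈ offsetWindow pbar P ε,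
      w (phase κ pbar x₀ x ε k - j) * V (angle κ ε k) (offset pbar ε j)) (𝓝[>] 0)
      (𝓝 ((∫ r, w r) * ∫ α in (-Real.pi)..Real.pi, V α (inner ℝ (unitVec α) x₀))) := by
  obtain ⟨F, hF, hFint⟩ := exists_periodization hwc hw
  have hgc : ContinuousOn (fun α => V α (inner ℝ (unitVec α) x₀))
      (Set.Icc (-Real.pi) Real.pi) := by
    refine hV.comp (f := fun α => (α, inner ℝ (unitVec α) x₀))
      (continuous_id.prodMk (continuous_inner_unitVec x₀)).continuousOn fun α hα => ?_
    exact ⟨hα, abs_le.1 ((abs_inner_unitVec_le α x₀).trans hP)⟩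
  have hm : ∀ m : ℤ, m ≠ 0 → ∀ᵐ α : ℝ,
      fourier m ((κ * inner ℝ (unitVec (α + Real.pi / 2)) x₀ : ℝ) : AddCircle (1 : ℝ)) ≠ 1 := by
    intro m hm0
    have h : ∀ᵐ α : ℝ, ∀ n : ℤ, inner ℝ (unitVec (α + Real.pi / 2)) x₀ ≠ n / (m * κ) :=
      ae_all_iff.2 fun n =>
        (measurePreserving_add_right volume (Real.pi / 2)).quasiMeasurePreserving.ae
          (ae_inner_unitVec_ne hx₀ (n / (m * κ)))
    filter_upwards [h] with α hα
    rw [Ne, fourier_coe_eq_one_iff]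
    rintro ⟨n, hn⟩
    have hm' : (m : ℝ) ≠ 0 := by exact_mod_cast hm0
    refine hα n ?_
    rw [← hn]
    field_simp
  have hmain := tendsto_sum_comp_addCircle hκ hgc
    (β := fun α => κ * inner ℝ (unitVec (α + Real.pi / 2)) x₀)
    (((continuous_inner_unitVec x₀).comp
      (continuous_add_const (Real.pi / 2))).measurable.const_mul κ)
    (u := phase κ pbar x₀ x) (fun α l => tendsto_phase_increment hκ pbar x₀ x α l) hm F
  have hre := (Complex.continuous_re.tendsto _).comp hmain
  rw [hFint, ← Complex.ofReal_mul, Complex.ofReal_re, mul_comm] at hre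
  have := hre.add (tendsto_grid_sum_sub (pbar := pbar) hκ hx₀ hP x hw hV)
  rw [add_zero] at this
  refine this.congr fun ε => ?_
  simp only [Function.comp_apply, hF, ← Complex.ofReal_mul, ← Complex.ofReal_sum,
    Complex.real_smul, Complex.ofReal_re, smul_eq_mul]
  rw [← mul_add, ← Finset.sum_add_distrib]
  congr 1
  exact Finset.sum_congr rfl fun k _ => by ring

/-! ### The Lyapunov ratio -/

theorem weight_eq (κ pbar : ℝ) (φ : ℝ → ℝ) (x₀ x : EuclideanSpace ℝ (Fin 2)) (ε : ℝ) (k j : ℤ) :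
    weight κ pbar φ x₀ x ε (k, j)
      = hilbertTransform (deriv φ) (phase κ pbar x₀ x ε k - j) := by
  rw [weight, phase]
  congr 1
  ring

theorem abs_pow_le_of_abs_le_div {h : ℝ → ℝ} {K : ℝ} (hh : ∀ t, |h t| ≤ K / (1 + t ^ 2)) {n : ℕ}
    (hn : n ≠ 0) (t : ℝ) : |h t| ^ n ≤ K ^ n / (1 + t ^ 2) := by
  have hK : 0 ≤ K := nonneg_of_forall_abs_le_div hh
  calc |h t| ^ n ≤ (K / (1 + t ^ 2)) ^ n := pow_le_pow_left₀ (abs_nonneg _) (hh t) n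
    _ = K ^ n / (1 + t ^ 2) ^ n := div_pow _ _ _
    _ ≤ K ^ n / (1 + t ^ 2) :=
      div_le_div_of_nonneg_left (by positivity) (by positivity)
        (le_self_pow₀ (by nlinarith [sq_nonneg t]) hn)

variable {Ω : Type*} [MeasurableSpace Ω] {μ : Measure Ω}
  {κ pbar P : ℝ} {σ : ℝ → ℝ → ℝ} {η : ℝ → ℤ → ℤ → Ω → ℝ} {φ : ℝ → ℝ}
  {x₀ : EuclideanSpace ℝ (Fin 2)}

theorem tendsto_varianceSum (hκ : 0 < κ) (hη : NoiseAssumptions μ κ pbar P σ η)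
    (hx₀ : x₀ ≠ 0) (hP : ‖x₀‖ ≤ P) (x : EuclideanSpace ℝ (Fin 2)) {K : ℝ}
    (hc : Continuous (hilbertTransform (deriv φ)))
    (hK : ∀ t, |hilbertTransform (deriv φ) t| ≤ K / (1 + t ^ 2)) :
    Tendsto (fun ε => varianceSum μ κ pbar P φ η x₀ x ε) (𝓝[>] 0)
      (𝓝 ((∫ r, hilbertTransform (deriv φ) r ^ 2)
        * ∫ α in (-Real.pi)..Real.pi, σ α (inner ℝ (unitVec α) x₀) ^ 2)) := by
  have hlim := tendsto_grid_sum (pbar := pbar) hκ hx₀ hP x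
    (w := fun t => hilbertTransform (deriv φ) t ^ 2) (K := K ^ 2) (hc.pow 2)
    (fun t => by simpa using abs_pow_le_of_abs_le_div hK two_ne_zero t)
    (V := fun α p => σ α p ^ 2)
    ((continuous_pow 2).comp_continuousOn hη.sigma_contDiffOn.continuousOn)
  refine hlim.congr' ?_
  filter_upwards [self_mem_nhdsWithin] with ε hε
  have hsecond : varianceSum μ κ pbar P φ η x₀ x ε = ∑ i ∈ grid κ pbar P ε,
      weight κ pbar φ x₀ x ε i ^ 2 * (σ (angle κ ε i.1) (offset pbar ε i.2) ^ 2 * (κ * ε)) :=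
    Finset.sum_congr rfl fun i hi => by rw [hη.second_moment ε hε i hi]
  rw [hsecond, sum_grid, smul_eq_mul, Finset.mul_sum]
  refine Finset.sum_congr rfl fun k _ => ?_
  rw [Finset.mul_sum]
  refine Finset.sum_congr rfl fun j _ => ?_
  rw [weight_eq]
  ring

theorem thirdMomentSum_isBigO (hκ : 0 < κ) (hη : NoiseAssumptions μ κ pbar P σ η)
    (x : EuclideanSpace ℝ (Fin 2)) {K : ℝ}
    (hK : ∀ t, |hilbertTransform (deriv φ) t| ≤ K / (1 + t ^ 2)) :
    (fun ε => thirdMomentSum μ κ pbar P φ η x₀ x ε) =O[𝓝[>] 0] fun ε => ε ^ (1 / 2 : ℝ) := by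
  obtain ⟨c, hc⟩ := hη.third_moment
  set B : ℝ := ∑' i : ℤ, 3 * K ^ 3 / (1 + (i : ℝ) ^ 2) with hB
  have hsum : ∀ (u : ℝ) (J : Finset ℤ),
      ∑ j ∈ J, |hilbertTransform (deriv φ) (u - j)| ^ 3 ≤ B := by
    intro u J
    have := sum_abs_comp_sub_le (w := fun t => |hilbertTransform (deriv φ) t| ^ 3) (K := K ^ 3)
      (fun t => by simpa using abs_pow_le_of_abs_le_div hK three_ne_zero t) u J
    simpa using this
  have hB0 : 0 ≤ B := by simpa using hsum 0 ∅
  refine Asymptotics.IsBigO.of_bound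
    (B * |c| * κ ^ (1 / 2 : ℝ) * (2 * Real.pi + 1)) ?_
  filter_upwards [eventually_card_angleWindow_lt hκ, self_mem_nhdsWithin] with ε hcard hε
  have hε : 0 < ε := hε
  have hp : 0 < κ * ε := mul_pos hκ hε
  have hnn : 0 ≤ thirdMomentSum μ κ pbar P φ η x₀ x ε :=
    Finset.sum_nonneg fun i _ => mul_nonneg (by positivity)
      (integral_nonneg fun ω => by positivity)
  rw [Real.norm_of_nonneg hnn, Real.norm_of_nonneg (by positivity)]
  have h32 : (κ * ε) ^ (3 / 2 : ℝ) = (κ * ε) * (κ ^ (1 / 2 : ℝ) * ε ^ (1 / 2 : ℝ)) := by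
    rw [← Real.mul_rpow hκ.le hε.le, show (3 / 2 : ℝ) = 1 + 1 / 2 by norm_num,
      Real.rpow_add hp, Real.rpow_one]
  calc thirdMomentSum μ κ pbar P φ η x₀ x ε
      ≤ ∑ i ∈ grid κ pbar P ε,
          |weight κ pbar φ x₀ x ε i| ^ 3 * (|c| * (κ * ε) ^ (3 / 2 : ℝ)) := by
        refine Finset.sum_le_sum fun i hi => mul_le_mul_of_nonneg_left ?_ (by positivity)
        exact (hc ε hε i hi).trans
          (mul_le_mul_of_nonneg_right (le_abs_self c) (Real.rpow_nonneg hp.le _))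
    _ = (∑ k ∈ angleWindow κ ε, ∑ j ∈ offsetWindow pbar P ε,
          |hilbertTransform (deriv φ) (phase κ pbar x₀ x ε k - j)| ^ 3)
          * (|c| * (κ * ε) ^ (3 / 2 : ℝ)) := by
        rw [← Finset.sum_mul, sum_grid]
        simp only [weight_eq]
    _ ≤ ((angleWindow κ ε).card * B) * (|c| * (κ * ε) ^ (3 / 2 : ℝ)) := by
        refine mul_le_mul_of_nonneg_right ?_ (by positivity)
        refine (Finset.sum_le_sum fun k _ => hsum _ _).trans ?_
        simp
    _ = B * |c| * κ ^ (1 / 2 : ℝ) * (κ * ε * (angleWindow κ ε).card) * ε ^ (1 / 2 : ℝ) := by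
        rw [h32]
        ring
    _ ≤ _ := by gcongr

theorem integral_sq_sigma_pos {ν : ℝ} (hη : NoiseAssumptions μ κ pbar P σ η)
    (hx₀ : CenterAssumptions κ P ν σ x₀) :
    0 < ∫ α in (-Real.pi)..Real.pi, σ α (inner ℝ (unitVec α) x₀) ^ 2 := by
  have hgc : ContinuousOn (fun α => σ α (inner ℝ (unitVec α) x₀) ^ 2)
      (Set.Icc (-Real.pi) Real.pi) := by
    refine (hη.sigma_contDiffOn.continuousOn.comp (f := fun α => (α, inner ℝ (unitVec α) x₀))
      (continuous_id.prodMk (continuous_inner_unitVec x₀)).continuousOn fun α hα => ?_).pow 2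
    exact ⟨hα, abs_le.1 ((abs_inner_unitVec_le α x₀).trans hx₀.norm_le)⟩
  obtain ⟨U, hUo, ⟨α₀, hα₀⟩, hUs, hU⟩ := hx₀.sigma_ne_zero
  have hpi := Real.pi_pos
  refine intervalIntegral.integral_pos (by linarith) hgc (fun α _ => sq_nonneg _) ?_
  exact ⟨α₀, hUs hα₀, lt_of_le_of_ne (sq_nonneg _) (hU α₀ hα₀).symm⟩

end NoisyFBP

theorem mainTheorem3 {Ω : Type*} [MeasurableSpace Ω] (μ : Measure Ω) [IsProbabilityMeasure μ]
    (κ pbar P ν : ℝ) (M : ℕ) (σ : ℝ → ℝ → ℝ) (η : ℝ → ℤ → ℤ → Ω → ℝ) (φ : ℝ → ℝ)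
    (x₀ x : EuclideanSpace ℝ (Fin 2)) (hκ : 0 < κ)
    (hη : NoisyFBP.NoiseAssumptions μ κ pbar P σ η)
    (hφ : NoisyFBP.KernelAssumptions M φ) (hM : ν + 1 < M)
    (hx₀ : NoisyFBP.CenterAssumptions κ P ν σ x₀) :
    (fun ε : ℝ => NoisyFBP.thirdMomentSum μ κ pbar P φ η x₀ x ε /
        (NoisyFBP.varianceSum μ κ pbar P φ η x₀ x ε) ^ (3 / 2 : ℝ))
      =O[𝓝[>] (0 : ℝ)] (fun ε : ℝ => ε ^ (1 / 2 : ℝ)) ∧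
    Tendsto (fun ε : ℝ => NoisyFBP.varianceSum μ κ pbar P φ η x₀ x ε) (𝓝[>] (0 : ℝ))
      (𝓝 ((∫ r : ℝ, (NoisyFBP.hilbertTransform (deriv φ) r) ^ 2) *
        ∫ α in (-Real.pi)..Real.pi, (σ α (inner ℝ (NoisyFBP.unitVec α) x₀)) ^ 2)) ∧
    0 < (∫ r : ℝ, (NoisyFBP.hilbertTransform (deriv φ) r) ^ 2) *
        ∫ α in (-Real.pi)..Real.pi, (σ α (inner ℝ (NoisyFBP.unitVec α) x₀)) ^ 2 := by
  have hφ2 : ContDiff ℝ 2 φ :=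
    hφ.contDiff.of_le (by exact_mod_cast (by norm_num : 2 ≤ 3).trans hφ.three_le)
  have hc := NoisyFBP.continuous_hilbertTransform (NoisyFBP.contDiff_one_deriv hφ2)
    hφ.compactSupport.deriv
  obtain ⟨K, hK⟩ := NoisyFBP.exists_hilbertTransform_deriv_bound hφ2 hφ.compactSupport
    hφ.integral_eq_one
  have hne : x₀ ≠ 0 := by
    rintro rfl
    have := hx₀.type.2.1
    simp at this
  have hint : Integrable fun r => NoisyFBP.hilbertTransform (deriv φ) r ^ 2 := by
    refine Integrable.mono' (integrable_inv_one_add_sq.const_mul (K ^ 2))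
      (hc.pow 2).aestronglyMeasurable (Eventually.of_forall fun r => ?_)
    simpa [div_eq_mul_inv] using NoisyFBP.abs_pow_le_of_abs_le_div hK two_ne_zero r
  have hvar := NoisyFBP.tendsto_varianceSum hκ hη hne hx₀.norm_le x hc hK
  have hpos := mul_pos (NoisyFBP.integral_sq_hilbertTransform_deriv_pos hφ2 hφ.compactSupport
    hφ.integral_eq_one hint) (NoisyFBP.integral_sq_sigma_pos hη hx₀)
  refine ⟨?_, hvar, hpos⟩
  have hinv := (hvar.rpow_const (p := (3 / 2 : ℝ)) (Or.inl hpos.ne')).inv₀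
    (Real.rpow_pos_of_pos hpos _).ne'
  simpa [div_eq_mul_inv] using
    (NoisyFBP.thirdMomentSum_isBigO (x₀ := x₀) hκ hη x hK).mul (hinv.isBigO_one ℝ)
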